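/- **Definitions.** Let $G$ be a locally compact group, $K\subset G$ a compact subgroup and $H\subset G$ an infinite discrete subgroup. For a finitely supported function $f:H\to\mathbb C$ let $\|f\|_{C^*_r(H)}$ be the norm of the operator $\xi\mapsto f*\xi$ on $\ell^2(H)$. For a function $c:G\to\mathbb C$ and a set $B\subset G$ put $$\|\mathrm{Sch}_c|_{C(H\cap B)}\|=\sup\{\|c f\|_{C^*_r(H)} : f:H\to\mathbb C \text{ finitely supported},\ \mathrm{supp}(f)\subset B,\ \|f\|_{C^*_r(H)}\le 1\}\in[0,\infty],$$ where $(cf)(h)=c(h)f(h)$ for $h\in H$. A length function on $G$ is a map $\ell:G\to\mathbb R_{\ge 0}$ with $\ell(1)=0$, $\ell(g^{-1})=\ell(g)$ and $\ell(gh)\le\ell(g)+\ell(h)$; write $B_n=\{g\in G:\ell(g)\le n\}$. The group $H$ has *property $(T_{Schur},G,K)$* if for every continuous length function $\ell$ on $G$ there is $s_0>0$ such that for every $s\in[0,s_0)$ there is a continuous real-valued function $\phi\in C_0(G)$ vanishing at infinity with the following property: for every $C>0$ and every $K$-biinvariant continuous function $c:G\to\mathbb C$ satisfying $$\|\mathrm{Sch}_c|_{C(H\cap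 B_n)}\|\le C e^{sn}\quad\text{for all } n\in\mathbb N=\{0,1,2,\dots\},$$ there is $c_\infty\in\mathbb C$ with $|c(g)-c_\infty|\le C\,\phi(g)$ for all $g\in G$. **Theorem.** Let $\mathbb F_q$ be a finite field of characteristic different from $2$. For a commutative ring $R$ let $Sp_4(R)$ be the group of matrices $A\in GL_4(R)$ with $AJ\,{}^tA=J$, where $$J=\begin{pmatrix}0&0&0&1\\0&0&1&0\\0&-1&0&0\\-1&0&0&0\end{pmatrix}.$$ Let $G=Sp_4(\mathbb F_q((\pi)))$ with the $\pi$-adic topology, $K=Sp_4(\mathbb F_q[[\pi]])$ and $\Gamma=Sp_4(\mathbb F_q[\pi^{-1}])$ (a non-cocompact lattice in $G$), and let $H\subset\Gamma$ be the subgroup of upper triangular matrices with all diagonal entries equal to $1$. Then $H$ has property $(T_{Schur},G,K)$. Consequently, $\Gamma$ also has property $(T_{Schur},G,K)$. -/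

import Mathlib

open scoped LaurentSeries PowerSeries ENNReal ZeroAtInfty

noncomputable section

/-! ### The reduced C*-norm of a discrete group -/

/-- The unitary `ξ ↦ (x ↦ ξ (a⁻¹ x))` of `ℓ²(H)`: left translation by `a`. -/
def leftTranslation {H : Type*} [Group H] (a : H) :
    lp (fun _ : H => ℂ) 2 →ₗᵢ[ℂ] lp (fun _ : H => ℂ) 2 where
  toFun ξ := ⟨fun x => ξ (a⁻¹ * x), by
    have h := (lp.memℓp ξ).summable (by norm_num)
    exact memℓp_gen ((Equiv.mulLeft a⁻¹).summable_iff.mpr h)⟩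
  map_add' _ _ := rfl
  map_smul' _ _ := rfl
  norm_map' ξ := by
    have hp : 0 < (2 : ℝ≥0∞).toReal := by norm_num
    rw [lp.norm_eq_tsum_rpow hp, lp.norm_eq_tsum_rpow hp]
    congr 1
    exact (Equiv.mulLeft a⁻¹).tsum_eq (fun x => ‖ξ x‖ ^ (2 : ℝ≥0∞).toReal)

/-- The left regular representation of `ℂ[H]` on `ℓ²(H)`: a finitely supported `f` acts by the
convolution operator `λ(f) = ∑ₐ f(a) λ(a)`. -/
def leftRegular {H : Type*} [Group H] (f : H →₀ ℂ) :
    lp (fun _ : H => ℂ) 2 →L[ℂ] lp (fun _ : H => ℂ) 2 :=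
  f.sum fun a z => z • (leftTranslation a).toContinuousLinearMap

/-- The norm of a finitely supported function in the reduced C*-algebra `C*_r(H)`
of the discrete group `H`. -/
def reducedNorm {H : Type*} [Group H] (f : H →₀ ℂ) : ℝ :=
  ‖leftRegular f‖

/-! ### Schur multipliers and the property -/

/-- The Schur (pointwise) product `h ↦ c h * f h`. -/
def schurProduct {H : Type*} (c : H → ℂ) (f : H →₀ ℂ) : H →₀ ℂ :=
  Finsupp.onFinset f.support (fun h => c h * f h) fun h hh => by
    rw [Finsupp.mem_support_iff]
    exact right_ne_zero_of_mul hh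

/-- The norm of the Schur product by `c` on the space of finitely supported functions on the
discrete subgroup `H` that are supported in `B`, for the norm of `C*_r(H)`
(possibly infinite). -/
def schurNorm {G : Type*} [Group G] (H : Subgroup G) (c : G → ℂ) (B : Set G) : ℝ≥0∞ :=
  ⨆ f : {f : H →₀ ℂ // (∀ h ∈ f.support, (h : G) ∈ B) ∧ reducedNorm f ≤ 1},
    ENNReal.ofReal (reducedNorm (schurProduct (fun h : H => c h) f.1))

/-- Property `(T_Schur, G, K)` for a discrete subgroup `H` of the topological group `G`.
For discrete `H`, `C_c(H)` is the space of finitely supported functions.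
A length function is a map `ℓ : G → ℝ` with `ℓ 1 = 0`, `ℓ g⁻¹ = ℓ g`,
`ℓ (g * h) ≤ ℓ g + ℓ h` (hence `ℓ ≥ 0`), that is, a `GroupSeminorm`. -/
def HasTSchur {G : Type*} [Group G] [TopologicalSpace G] (K H : Subgroup G)
    [DiscreteTopology H] : Prop :=
  ∀ ℓ : GroupSeminorm G, Continuous ℓ →
    ∃ s₀ : ℝ, 0 < s₀ ∧ ∀ s : ℝ, 0 ≤ s → s < s₀ →
      ∃ φ : C₀(G, ℝ), ∀ C : ℝ, 0 < C → ∀ c : C(G, ℂ),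
        (∀ k ∈ K, ∀ k' ∈ K, ∀ g : G, c (k * g * k') = c g) →
        (∀ n : ℕ, schurNorm H c {g | ℓ g ≤ n} ≤ ENNReal.ofReal (C * Real.exp (s * n))) →
        ∃ cinf : ℂ, ∀ g : G, ‖c g - cinf‖ ≤ C * φ g

/-! ### The symplectic groups -/

/-- The matrix of the symplectic form. -/
def sympJ (R : Type*) [CommRing R] : Matrix (Fin 4) (Fin 4) R :=
  !![0, 0, 0, 1; 0, 0, 1, 0; 0, -1, 0, 0; -1, 0, 0, 0]

/-- `Sp₄(R)`, the invertible matrices `A` with `A J Aᵀ = J`. Over a topological ring it carries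
the topology induced by `GL₄(R)`, that is, by its matrix entries. -/
def Sp4 (R : Type*) [CommRing R] : Subgroup (GL (Fin 4) R) where
  carrier := {A | A.val * sympJ R * A.val.transpose = sympJ R}
  one_mem' := by simp
  mul_mem' := by
    intro A B hA hB
    simp only [Set.mem_ofPred_eq, Units.val_mul, Matrix.transpose_mul] at *
    calc A.val * B.val * sympJ R * (B.val.transpose * A.val.transpose)
        = A.val * (B.val * sympJ R * B.val.transpose) * A.val.transpose := by
          simp only [Matrix.mul_assoc]
      _ = sympJ R := by rw [hB, hA]
  inv_mem' := by
    intro A hA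
    simp only [Set.mem_ofPred_eq] at *
    have h1 : (A⁻¹).val * A.val = 1 := Units.inv_mul A
    have h2 : A.val.transpose * (A⁻¹).val.transpose = 1 := by
      rw [← Matrix.transpose_mul, h1, Matrix.transpose_one]
    calc (A⁻¹).val * sympJ R * (A⁻¹).val.transpose
        = (A⁻¹).val * (A.val * sympJ R * A.val.transpose) * (A⁻¹).val.transpose := by rw [hA]
      _ = ((A⁻¹).val * A.val) * sympJ R * (A.val.transpose * (A⁻¹).val.transpose) := by
          simp only [Matrix.mul_assoc]
      _ = sympJ R := by rw [h1, h2, Matrix.one_mul, Matrix.mul_one]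

/-- The image of `Sp₄(R)` in `Sp₄(S)` under a ring homomorphism `R → S`. -/
def Sp4Image {R S : Type*} [CommRing R] [CommRing S] (f : R →+* S) : Subgroup (Sp4 S) :=
  ((Sp4 R).map (Matrix.GeneralLinearGroup.map f)).subgroupOf (Sp4 S)

/-- The upper triangular matrices with diagonal entries `1` in `Sp₄(R)`. -/
def Sp4Unipotent (R : Type*) [CommRing R] : Subgroup (Sp4 R) where
  carrier := {A | (∀ i j, j < i → A.1.val i j = 0) ∧ ∀ i, A.1.val i i = 1}
  one_mem' := by
    refine ⟨fun i j hij => ?_, fun i => ?_⟩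
    · simp [hij.ne']
    · simp
  mul_mem' := by
    rintro A B ⟨hA, hA'⟩ ⟨hB, hB'⟩
    refine ⟨?_, ?_⟩
    · intro i j hij
      simp only [Subgroup.coe_mul, Units.val_mul, Matrix.mul_apply]
      refine Finset.sum_eq_zero fun k _ => ?_
      rcases lt_or_ge k i with h | h
      · rw [hA i k h, zero_mul]
      · rw [hB k j (hij.trans_le h), mul_zero]
    · intro i
      simp only [Subgroup.coe_mul, Units.val_mul, Matrix.mul_apply]
      rw [Finset.sum_eq_single i, hA', hB', one_mul]
      · intro k _ hk
        rcases lt_or_gt_of_ne hk with h | h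
        · rw [hA i k h, zero_mul]
        · rw [hB k i h, mul_zero]
      · simp
  inv_mem' := by
    rintro A ⟨hA, hA'⟩
    have hm : ∀ i j, ∑ k, (A⁻¹).1.val i k * A.1.val k j = if i = j then 1 else 0 := by
      intro i j
      have h : (A⁻¹).1.val * A.1.val = 1 := by simp
      rw [← Matrix.mul_apply, h, Matrix.one_apply]
    have key : ∀ j i, j ≤ i → (A⁻¹).1.val i j = if i = j then 1 else 0 := by
      intro j
      induction j using WellFoundedLT.induction with
      | ind j ih =>
        intro i hij
        rw [← hm i j, Finset.sum_eq_single j, hA', mul_one]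
        · intro k _ hk
          rcases lt_or_gt_of_ne hk with h | h
          · rw [ih k h i (h.le.trans hij), if_neg (h.trans_le hij).ne', zero_mul]
          · rw [hA k j h, mul_zero]
        · simp
    refine ⟨fun i j hij => ?_, fun i => ?_⟩
    · simpa [hij.ne'] using key j i hij.le
    · simpa using key i i le_rfl

/-! ### The groups over `F_q((π))` -/

/-- The subring `F_q[π⁻¹]` of `F_q((π))`. -/
def polyInv (Fq : Type*) [Field Fq] : Subalgebra Fq Fq⸨X⸩ :=
  Algebra.adjoin Fq {HahnSeries.single (-1 : ℤ) (1 : Fq)}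

/-- `G = Sp₄(F_q((π)))`, with the `π`-adic topology. -/
abbrev SpG (Fq : Type*) [Field Fq] : Type _ := Sp4 Fq⸨X⸩

/-- `K = Sp₄(F_q[[π]])`. -/
def SpK (Fq : Type*) [Field Fq] : Subgroup (SpG Fq) :=
  Sp4Image (algebraMap Fq⟦X⟧ Fq⸨X⸩)

/-- `Γ = Sp₄(F_q[π⁻¹])`. -/
def SpΓ (Fq : Type*) [Field Fq] : Subgroup (SpG Fq) :=
  Sp4Image (polyInv Fq).val.toRingHom

/-- The upper triangular unipotent subgroup of `Γ`. -/
def SpH (Fq : Type*) [Field Fq] : Subgroup (SpG Fq) :=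
  SpΓ Fq ⊓ Sp4Unipotent Fq⸨X⸩

/-! ### `Γ` and `H` are discrete -/

theorem polyInv_coeff {Fq : Type*} [Field Fq] {x : Fq⸨X⸩} (hx : x ∈ polyInv Fq) :
    ∀ n : ℤ, 0 < n → x.coeff n = 0 := by
  induction hx using Algebra.adjoin_induction with
  | mem x hx =>
    intro n hn
    rw [Set.mem_singleton_iff.mp hx, HahnSeries.coeff_single_of_ne (by omega)]
  | algebraMap r =>
    intro n hn
    rw [LaurentSeries.algebraMap_apply]
    exact HahnSeries.coeff_single_of_ne hn.ne'
  | add x y _ _ hx hy =>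
    intro n hn
    rw [HahnSeries.coeff_add, hx n hn, hy n hn, add_zero]
  | mul x y _ _ hx hy =>
    intro n hn
    rw [HahnSeries.coeff_mul]
    refine Finset.sum_eq_zero fun p hp => ?_
    have h := (Finset.mem_antidiagonal.mp hp).2.2
    rcases lt_or_ge 0 p.1 with h1 | h1
    · rw [hx _ h1, zero_mul]
    · rw [hy p.2 (by omega), mul_zero]

instance polyInv_discrete (Fq : Type*) [Field Fq] : DiscreteTopology (polyInv Fq) := by
  refine discreteTopology_of_isOpen_singleton_zero ?_
  have ho : IsOpen {x : Fq⸨X⸩ | Valued.v x < 1} := by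
    simpa [Valuation.restrict_lt_one_iff] using Valued.isOpen_ball Fq⸨X⸩ 1
  convert ho.preimage (continuous_subtype_val (p := fun x => x ∈ polyInv Fq)) using 1
  ext ⟨x, hx⟩
  simp only [Set.mem_singleton_iff, Set.mem_preimage, Set.mem_ofPred_eq]
  constructor
  · intro h
    have h0 : x = 0 := congrArg Subtype.val h
    simp [h0]
  · intro h
    refine Subtype.ext (HahnSeries.ext (funext fun n => ?_))
    rcases lt_or_ge 0 n with hn | hn
    · exact polyInv_coeff hx n hn
    · have h1 : Valued.v x ≤ WithZero.exp (-1 : ℤ) := by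
        rw [← WithZero.lt_mul_exp_iff_le (by simp)]
        simpa [← WithZero.exp_add] using h
      exact LaurentSeries.coeff_zero_of_lt_valuation Fq h1 (by omega)

instance SpΓ_discrete (Fq : Type*) [Field Fq] : DiscreteTopology (SpΓ Fq) := by
  have hmem : ∀ (g : SpΓ Fq) (i j : Fin 4), g.1.1.val i j ∈ polyInv Fq := by
    intro g i j
    obtain ⟨A, -, hA⟩ := Subgroup.mem_subgroupOf.mp g.2
    rw [← hA]
    exact (A.val i j).2
  have hval : Continuous fun g : SpΓ Fq => g.1.1.val :=
    Units.continuous_val.comp (continuous_subtype_val.comp continuous_subtype_val)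
  let F : SpΓ Fq → Matrix (Fin 4) (Fin 4) (polyInv Fq) := fun g i j => ⟨g.1.1.val i j, hmem g i j⟩
  have hF : Continuous F :=
    continuous_matrix fun i j => (hval.matrix_elem i j).subtype_mk _
  refine DiscreteTopology.of_continuous_injective hF fun g g' h => ?_
  refine Subtype.ext (Subtype.ext (Units.ext (Matrix.ext fun i j => ?_)))
  exact congrArg Subtype.val (congrFun (congrFun h i) j)

instance SpH_discrete (Fq : Type*) [Field Fq] : DiscreteTopology (SpH Fq) :=
  DiscreteTopology.of_continuous_injective
    (f := Subgroup.inclusion (inf_le_left : SpH Fq ≤ SpΓ Fq))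
    (continuous_subtype_val.subtype_mk _) (Subgroup.inclusion_injective _)

end

/-!
Write `T = π⁻¹`, `q = |F_q|`, and let `D(i, j)`, for `0 ≤ j ≤ i`, be the diagonal matrix
`(Tⁱ, Tʲ, T⁻ʲ, T⁻ⁱ)`. By the Cartan decomposition (`exists_kEquiv_cartan`) a `K`-biinvariant
function `c` is given by its values `c(i, j) = c(D(i, j))`, where `qⁱ` is the norm of the largest
entry of `g ∈ K D(i, j) K` and `j` can be read off from the Schur complement of that entry
(`kEquiv_cartan_of_corner`). The point is to compare neighbouring values of `c` by means of test
functions on `H` which have a small norm in the reduced C*-algebra and take opposite values on two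
double cosets.

The test functions have the form `∑ h b * Z (w + z₁) - ∑ h b * Z (w + z₂)`, where `b` and `w` run
through finite groups of polynomials, `Z` is a homomorphism, and `(h b)⁻¹ * h (b + t)` depends on
`b` only through a factor `Z (L t b)` with `L t` additive. If `f` is such a function, `f* f` is a
sum over `t` of terms which vanish as soon as `z₁ - z₂` lies in the sum of the range of `L t` and
of the group of the `w`; this holds for most `t`, hence the bound for the norm of `f`
(`reducedNorm_sum_le`). Conversely, `f` lives, up to a translation, on a finite group, and the
indicator function of this group shows that the norm of `c f` is at least the difference of the two
values of `c` (`norm_sub_le_of_schurNorm_le`). There are two families.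

* In the Siegel unipotent radical one takes `a = Tⁱ`, `b` arbitrary and `d = ⌊b² / Tⁱ⌋ + e` with
  `deg e = j`. The element lies in the double coset of `D(i, j)`, and `L t b = ⌊2 b t / Tⁱ⌋`, which
  is where the characteristic must differ from `2`. This compares `(i, j + 1)` and `(i, j)`, with
  an error of order `q ^ (-(i - j) / 2)`.
* In the Heisenberg group one takes `deg x = m`, `deg y < m`, `deg z = i`. This compares
  `(i + 1, j)` and `(i, j + 1)` with an error of order `q ^ (-j / 2)`, for `i + 1 + j = 2 m`, and a
  translation by a fixed element of `H` gives the case `i + 1 + j = 2 m + 1`.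

The hypothesis on `c` multiplies these errors by `C exp (s n)` with `n = O(i)`
(`exists_length_bound`), which is harmless for small `s`. The first comparison is good away from the
diagonal `j = i`, the second one away from the axis `j = 0`, and a zigzag between both shows that
`c(i, j)` converges exponentially fast in `i` (`exists_limit_of_zigzag`). Only elements of `H`
are used, so the argument applies to every discrete subgroup that contains `H`.
-/

noncomputable section

/-! ### A van der Corput inequality -/

/-- Van der Corput: if for all shifts `t` outside `bad` the correlations of `u` with its translate
by `t` sum to zero, then the sum of `u` is small. -/
theorem norm_sum_sq_le_of_correlation_eq_zero {E V : Type*} [NormedAddCommGroup E]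
    [InnerProductSpace ℂ E] [AddCommGroup V] [Fintype V] (u : V → E) {r : ℝ}
    (hu : ∀ b, ‖u b‖ ≤ r) (bad : Finset V)
    (h : ∀ t ∉ bad, ∑ b, inner ℂ (u b) (u (b + t)) = 0) :
    ‖∑ b, u b‖ ^ 2 ≤ bad.card * Fintype.card V * r ^ 2 := by
  have h1 : inner ℂ (∑ b, u b) (∑ b, u b) = ∑ t, ∑ b, inner ℂ (u b) (u (b + t)) := by
    rw [sum_inner, Finset.sum_comm]
    refine Finset.sum_congr rfl fun b _ => ?_
    rw [inner_sum]
    exact (Equiv.sum_comp (Equiv.addLeft b) fun x => inner ℂ (u b) (u x)).symm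
  have h2 : ∑ t, ∑ b, inner ℂ (u b) (u (b + t)) =
      ∑ t ∈ bad, ∑ b, inner ℂ (u b) (u (b + t)) :=
    (Finset.sum_subset (Finset.subset_univ _) fun t _ ht => h t ht).symm
  have h3 : ‖∑ b, u b‖ ^ 2 = ‖inner ℂ (∑ b, u b) (∑ b, u b)‖ := by
    rw [inner_self_eq_norm_sq_to_K]
    simp
  rw [h3, h1, h2]
  calc ‖∑ t ∈ bad, ∑ b, inner ℂ (u b) (u (b + t))‖
      ≤ ∑ t ∈ bad, ∑ b : V, r ^ 2 := by
        refine norm_sum_le_of_le _ fun t _ => norm_sum_le_of_le _ fun b _ => ?_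
        refine (norm_inner_le_norm _ _).trans ?_
        rw [sq]
        exact mul_le_mul (hu _) (hu _) (norm_nonneg _) ((norm_nonneg _).trans (hu b))
    _ = bad.card * Fintype.card V * r ^ 2 := by
        simp [mul_assoc]

/-! ### The left regular representation -/

section Regular

variable {Λ : Type*} [Group Λ]

theorem leftTranslation_mul (a b : Λ) (ξ : lp (fun _ : Λ => ℂ) 2) :
    leftTranslation (a * b) ξ = leftTranslation a (leftTranslation b ξ) := by
  refine lp.ext (funext fun x => ?_)
  change ξ ((a * b)⁻¹ * x) = ξ (b⁻¹ * (a⁻¹ * x))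
  rw [mul_inv_rev, mul_assoc]

theorem inner_leftTranslation (a b : Λ) (ξ η : lp (fun _ : Λ => ℂ) 2) :
    inner ℂ (leftTranslation a ξ) (leftTranslation b η) =
      inner ℂ ξ (leftTranslation (a⁻¹ * b) η) := by
  rw [← LinearIsometry.inner_map_map (leftTranslation a) ξ, ← leftTranslation_mul,
    mul_inv_cancel_left]

theorem leftRegular_single (a : Λ) (z : ℂ) (ξ : lp (fun _ : Λ => ℂ) 2) :
    leftRegular (Finsupp.single a z) ξ = z • leftTranslation a ξ := by
  rw [leftRegular, Finsupp.sum_single_index (by simp)]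
  rfl

theorem leftRegular_add (f g : Λ →₀ ℂ) : leftRegular (f + g) = leftRegular f + leftRegular g :=
  Finsupp.sum_add_index' (fun _ => by simp) fun _ _ _ => by rw [add_smul]

theorem leftRegular_smul (z : ℂ) (f : Λ →₀ ℂ) : leftRegular (z • f) = z • leftRegular f := by
  rw [leftRegular, Finsupp.sum_smul_index' (fun _ => by simp), leftRegular, Finsupp.smul_sum]
  simp [mul_smul]

/-- `leftRegular` as a linear map. -/
def leftRegularHom (Λ : Type*) [Group Λ] :
    (Λ →₀ ℂ) →ₗ[ℂ] (lp (fun _ : Λ => ℂ) 2 →L[ℂ] lp (fun _ : Λ => ℂ) 2) where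
  toFun := leftRegular
  map_add' := leftRegular_add
  map_smul' := leftRegular_smul

theorem leftRegular_sum {ι : Type*} (s : Finset ι) (f : ι → Λ →₀ ℂ) :
    leftRegular (∑ i ∈ s, f i) = ∑ i ∈ s, leftRegular (f i) :=
  map_sum (leftRegularHom Λ) f s

theorem leftRegular_sub (f g : Λ →₀ ℂ) : leftRegular (f - g) = leftRegular f - leftRegular g :=
  map_sub (leftRegularHom Λ) f g

end Regular

theorem schurProduct_apply {Λ : Type*} (c : Λ → ℂ) (f : Λ →₀ ℂ) (h : Λ) :
    schurProduct c f h = c h * f h := rfl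

theorem schurProduct_smul {Λ : Type*} (c : Λ → ℂ) (z : ℂ) (f : Λ →₀ ℂ) :
    schurProduct c (z • f) = z • schurProduct c f := by
  ext h
  simp only [schurProduct_apply, Finsupp.smul_apply, smul_eq_mul]
  ring

theorem schurProduct_sub {Λ : Type*} (c : Λ → ℂ) (f g : Λ →₀ ℂ) :
    schurProduct c (f - g) = schurProduct c f - schurProduct c g := by
  ext h
  simp only [schurProduct_apply, Finsupp.sub_apply]
  ring

theorem schurProduct_sum {ι : Type*} {Λ : Type*} (c : Λ → ℂ) (s : Finset ι) (f : ι → Λ →₀ ℂ) :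
    schurProduct c (∑ i ∈ s, f i) = ∑ i ∈ s, schurProduct c (f i) := by
  ext h
  simp only [schurProduct_apply, Finsupp.finsetSum_apply, Finset.mul_sum]

theorem schurProduct_single {Λ : Type*} (c : Λ → ℂ) (a : Λ) (z : ℂ) :
    schurProduct c (Finsupp.single a z) = c a • Finsupp.single a z := by
  classical
  ext h
  simp only [schurProduct_apply, Finsupp.smul_apply, smul_eq_mul, Finsupp.single_apply]
  split_ifs with hh
  · rw [hh]
  · simp

/-- The defining inequality of `schurNorm`, for functions of arbitrary norm. -/
theorem reducedNorm_schurProduct_le {G : Type*} [Group G] {Λ : Subgroup G} {c : G → ℂ}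
    {B : Set G} {D r : ℝ} (hD : 0 ≤ D) (hS : schurNorm Λ c B ≤ ENNReal.ofReal D) (hr : 0 < r)
    (f : Λ →₀ ℂ) (hf : ∀ h ∈ f.support, (h : G) ∈ B) (hfr : reducedNorm f ≤ r) :
    reducedNorm (schurProduct (fun h : Λ => c h) f) ≤ r * D := by
  have hr' : ‖((r⁻¹ : ℝ) : ℂ)‖ = r⁻¹ := by
    rw [Complex.norm_real, Real.norm_of_nonneg (inv_nonneg.mpr hr.le)]
  have h1 : ENNReal.ofReal (reducedNorm
      (schurProduct (fun h : Λ => c h) (((r⁻¹ : ℝ) : ℂ) • f))) ≤ ENNReal.ofReal D := by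
    refine le_trans (le_iSup_of_le ⟨((r⁻¹ : ℝ) : ℂ) • f, ?_, ?_⟩ le_rfl) hS
    · intro h hh
      exact hf h (Finsupp.support_smul hh)
    · rw [reducedNorm, leftRegular_smul, norm_smul, hr', inv_mul_le_iff₀ hr, mul_one]
      exact hfr
  rw [ENNReal.ofReal_le_ofReal_iff hD, reducedNorm, schurProduct_smul, leftRegular_smul,
    norm_smul, hr', inv_mul_le_iff₀ hr] at h1
  exact h1

/-- The normalised indicator function of a nonempty finite set that is stable under left
translation by the elements of `S` is a unit vector invariant under `S`. -/
theorem exists_invariant_vector {Λ : Type*} [Group Λ] (L : Finset Λ) (hL : L.Nonempty)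
    (S : Set Λ) (hS : ∀ s ∈ S, ∀ x ∈ L, s * x ∈ L) :
    ∃ ξ : lp (fun _ : Λ => ℂ) 2, ξ ≠ 0 ∧ ∀ s ∈ S, leftTranslation s ξ = ξ := by
  classical
  have hmem : Memℓp (fun x : Λ => if x ∈ L then (1 : ℂ) else 0) 2 := by
    refine memℓp_gen (summable_of_ne_finset_zero (s := L) fun x hx => ?_)
    simp [hx]
  refine ⟨⟨_, hmem⟩, ?_, ?_⟩
  · intro h0
    obtain ⟨x, hx⟩ := hL
    have h1 := congrFun (congrArg (fun ξ : lp (fun _ : Λ => ℂ) 2 => (ξ : Λ → ℂ)) h0) x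
    simp [hx] at h1
  · intro s hs
    refine lp.ext (funext fun x => ?_)
    change (if s⁻¹ * x ∈ L then (1 : ℂ) else 0) = if x ∈ L then 1 else 0
    -- left translation by `s` is an injection of the finite set `L` into itself
    have himg : L.image (s * ·) = L := by
      refine Finset.eq_of_subset_of_card_le ?_ ?_
      · intro y hy
        obtain ⟨x, hx, rfl⟩ := Finset.mem_image.mp hy
        exact hS s hs x hx
      · rw [Finset.card_image_of_injective _ (mul_right_injective s)]
    have : s⁻¹ * x ∈ L ↔ x ∈ L := by
      conv_rhs => rw [← himg]
      constructor
      · intro h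
        exact Finset.mem_image.mpr ⟨_, h, mul_inv_cancel_left _ _⟩
      · intro h
        obtain ⟨y, hy, rfl⟩ := Finset.mem_image.mp h
        simpa using hy
    simp only [this]

/-! ### Comparing two values of a multiplier -/

/-- Let `h : V → Λ` be such that `(h b)⁻¹ * h (b + t) = k t * Z (L t b)` with `L t` additive and `Z`
a homomorphism. If `z₁ - z₂` lies in the range of `L t` plus `W` for most `t`, then
`∑ b, ∑ w, (h b * Z (w + z₁) - h b * Z (w + z₂))` has small norm in the reduced C*-algebra: for
such `t` the average of `Z (L t b + w)` over `b` and `w` does not distinguish `Z z₁` from `Z z₂`,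
so that the correlation at `t` vanishes. -/
theorem reducedNorm_sum_le {Λ V P : Type*} [Group Λ] [AddCommGroup V] [Fintype V]
    [AddCommGroup P] (W : AddSubgroup P) [Fintype W] (h k : V → Λ) (Z : Multiplicative P →* Λ)
    (L : V → V →+ P)
    (hk : ∀ b t, (h b)⁻¹ * h (b + t) = k t * Z (.ofAdd (L t b)))
    (z₁ z₂ : P) (bad : Finset V)
    (hbad : ∀ t ∉ bad, ∃ b, ∃ w ∈ W, z₁ - z₂ = L t b + w) :
    reducedNorm (∑ b, ∑ w : W, (Finsupp.single (h b * Z (.ofAdd (w + z₁))) (1 : ℂ) -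
      Finsupp.single (h b * Z (.ofAdd (w + z₂))) 1)) ≤
      2 * Fintype.card W * Real.sqrt (bad.card * Fintype.card V) := by
  refine ContinuousLinearMap.opNorm_le_bound _ (by positivity) fun ξ => ?_
  set ρ : P → lp (fun _ : Λ => ℂ) 2 →ₗᵢ[ℂ] lp (fun _ : Λ => ℂ) 2 :=
    fun p => leftTranslation (Z (.ofAdd p)) with hρ
  have hρadd : ∀ p p' η, ρ (p + p') η = ρ p (ρ p' η) := by
    intro p p' η
    rw [hρ]
    simp only
    rw [ofAdd_add, map_mul, leftTranslation_mul]
  set η := ∑ w : W, (ρ (w + z₁) ξ - ρ (w + z₂) ξ) with hη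
  have hηn : ‖η‖ ≤ 2 * Fintype.card W * ‖ξ‖ := by
    calc ‖η‖ ≤ ∑ w : W, 2 * ‖ξ‖ := by
          refine norm_sum_le_of_le _ fun w _ => (norm_sub_le _ _).trans ?_
          rw [LinearIsometry.norm_map, LinearIsometry.norm_map, two_mul]
      _ = 2 * Fintype.card W * ‖ξ‖ := by
          simp
          ring
  have hsum : leftRegular (∑ b, ∑ w : W, (Finsupp.single (h b * Z (.ofAdd (w + z₁))) (1 : ℂ) -
      Finsupp.single (h b * Z (.ofAdd (w + z₂))) 1)) ξ = ∑ b, leftTranslation (h b) η := by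
    simp only [leftRegular_sum, _root_.sum_apply, leftRegular_sub,
      _root_.sub_apply, leftRegular_single, one_smul, leftTranslation_mul, hη,
      map_sum, map_sub, hρ]
  rw [hsum]
  have hcorr : ∀ t ∉ bad, ∑ b, inner ℂ (leftTranslation (h b) η)
      (leftTranslation (h (b + t)) η) = 0 := by
    intro t ht
    obtain ⟨b₀, w₀, hw₀, hz⟩ := hbad t ht
    have h1 : ∑ b, ρ (L t b) η = 0 := by
      have h2 : ∑ b, ∑ w : W, ρ (L t b) (ρ (w + z₁) ξ) =
          ∑ b, ∑ w : W, ρ (L t b) (ρ (w + z₂) ξ) := by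
        have e : ∀ b, ∀ w : W, ρ (L t b) (ρ (w + z₁) ξ) =
            ρ (L t (b + b₀)) (ρ ((w + ⟨w₀, hw₀⟩ : W) + z₂) ξ) := by
          intro b w
          rw [← hρadd, ← hρadd]
          congr 2
          rw [map_add, AddSubgroup.coe_add, eq_add_of_sub_eq hz]
          abel
        simp only [e]
        rw [← Equiv.sum_comp (Equiv.addRight b₀) fun b => ∑ w : W, ρ (L t b) (ρ (w + z₂) ξ)]
        refine Finset.sum_congr rfl fun b _ => ?_
        exact Equiv.sum_comp (Equiv.addRight (⟨w₀, hw₀⟩ : W))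
          fun w : W => ρ (L t (b + b₀)) (ρ (w + z₂) ξ)
      rw [← sub_eq_zero] at h2
      rw [← h2]
      simp only [hη, map_sum, map_sub, Finset.sum_sub_distrib]
    have h3 : ∀ b, inner ℂ (leftTranslation (h b) η) (leftTranslation (h (b + t)) η) =
        inner ℂ η (leftTranslation (k t) (ρ (L t b) η)) := by
      intro b
      rw [inner_leftTranslation, hk, leftTranslation_mul]
    simp only [h3]
    rw [← inner_sum, ← map_sum, h1, map_zero, inner_zero_right]
  have h4 := norm_sum_sq_le_of_correlation_eq_zero (fun b => leftTranslation (h b) η)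
    (r := 2 * Fintype.card W * ‖ξ‖) (fun b => by rwa [LinearIsometry.norm_map]) bad hcorr
  refine (sq_le_sq₀ (norm_nonneg _) (by positivity)).mp ?_
  refine h4.trans (le_of_eq ?_)
  have hs : Real.sqrt (bad.card * Fintype.card V) ^ 2 = bad.card * Fintype.card V :=
    Real.sq_sqrt (by positivity)
  linear_combination -(2 * (Fintype.card W : ℝ) * ‖ξ‖) ^ 2 * hs

/-- Comparison of the two values `c₁`, `c₂` of a Schur multiplier on the elements
`u * h b * Z (w + z₁)`, `u * h b * Z (w + z₂)`. The finite set `F`, stable under left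
translation by these elements without the factor `u`, provides an invariant vector. -/
theorem norm_sub_le_of_schurNorm_le {G V P : Type*} [Group G] [AddCommGroup V] [Fintype V]
    [AddCommGroup P] {Λ : Subgroup G} {c : G → ℂ} {B : Set G} {D κ : ℝ} (hD : 0 ≤ D)
    (hS : schurNorm Λ c B ≤ ENNReal.ofReal D)
    (W : AddSubgroup P) [Fintype W] (u : Λ) (h k : V → Λ) (Z : Multiplicative P →* Λ)
    (L : V → V →+ P)
    (hk : ∀ b t, (h b)⁻¹ * h (b + t) = k t * Z (.ofAdd (L t b)))
    (z₁ z₂ : P) (bad : Finset V)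
    (hbad : ∀ t ∉ bad, ∃ b, ∃ w ∈ W, z₁ - z₂ = L t b + w)
    (hκ : 0 < κ) (hcard : bad.card ≤ κ ^ 2 * Fintype.card V)
    (F : Finset Λ) (hF : F.Nonempty)
    (hF₁ : ∀ b, ∀ w ∈ W, ∀ x ∈ F, h b * Z (.ofAdd (w + z₁)) * x ∈ F)
    (hF₂ : ∀ b, ∀ w ∈ W, ∀ x ∈ F, h b * Z (.ofAdd (w + z₂)) * x ∈ F)
    {c₁ c₂ : ℂ}
    (hc₁ : ∀ b, ∀ w ∈ W, ((u * h b * Z (.ofAdd (w + z₁)) : Λ) : G) ∈ B ∧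
      c ((u * h b * Z (.ofAdd (w + z₁)) : Λ) : G) = c₁)
    (hc₂ : ∀ b, ∀ w ∈ W, ((u * h b * Z (.ofAdd (w + z₂)) : Λ) : G) ∈ B ∧
      c ((u * h b * Z (.ofAdd (w + z₂)) : Λ) : G) = c₂) :
    ‖c₁ - c₂‖ ≤ 2 * κ * D := by
  classical
  set N : ℝ := Fintype.card V * Fintype.card W with hN
  have hNpos : 0 < N := by
    have h1 : 0 < Fintype.card V := Fintype.card_pos
    have h2 : 0 < Fintype.card W := Fintype.card_pos
    positivity
  set f : Λ →₀ ℂ := ∑ b, ∑ w : W, (Finsupp.single (u * h b * Z (.ofAdd (w + z₁))) (1 : ℂ) -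
      Finsupp.single (u * h b * Z (.ofAdd (w + z₂))) 1) with hf
  have hfB : ∀ x ∈ f.support, (x : G) ∈ B := by
    intro x hx
    obtain ⟨b, -, hb⟩ := Finset.mem_biUnion.mp (Finsupp.support_finsetSum hx)
    obtain ⟨w, -, hw⟩ := Finset.mem_biUnion.mp (Finsupp.support_finsetSum hb)
    rcases Finset.mem_union.mp (Finsupp.support_sub hw) with h1 | h1
    · rw [Finset.mem_singleton.mp (Finsupp.support_single_subset h1)]
      exact (hc₁ b w w.2).1
    · rw [Finset.mem_singleton.mp (Finsupp.support_single_subset h1)]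
      exact (hc₂ b w w.2).1
  have hfn : reducedNorm f ≤ 2 * κ * N := by
    refine (reducedNorm_sum_le W (fun b => u * h b) k Z L ?_ z₁ z₂ bad hbad).trans ?_
    · intro b t
      rw [← hk]
      group
    · have h1 : Real.sqrt (bad.card * Fintype.card V) ≤ κ * Fintype.card V := by
        rw [Real.sqrt_le_left (by positivity)]
        calc (bad.card : ℝ) * Fintype.card V
            ≤ κ ^ 2 * Fintype.card V * Fintype.card V :=
              mul_le_mul_of_nonneg_right hcard (by positivity)
          _ = (κ * Fintype.card V) ^ 2 := by ring
      calc 2 * (Fintype.card W : ℝ) * Real.sqrt (bad.card * Fintype.card V)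
          ≤ 2 * (Fintype.card W : ℝ) * (κ * Fintype.card V) :=
            mul_le_mul_of_nonneg_left h1 (by positivity)
        _ = 2 * κ * N := by rw [hN]; ring
  have hmain := reducedNorm_schurProduct_le hD hS (by positivity) f hfB hfn
  obtain ⟨ξ, hξ, hinv⟩ := exists_invariant_vector F hF
    {s | ∃ b, ∃ w ∈ W, s = h b * Z (.ofAdd (w + z₁)) ∨ s = h b * Z (.ofAdd (w + z₂))} (by
      rintro s ⟨b, w, hw, rfl | rfl⟩ x hx
      · exact hF₁ b w hw x hx
      · exact hF₂ b w hw x hx)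
  have hval : leftRegular (schurProduct (fun h : Λ => c h) f) ξ =
      ((N : ℂ) * (c₁ - c₂)) • leftTranslation u ξ := by
    have e₁ : ∀ b, ∀ w : W, leftRegular (schurProduct (fun h : Λ => c h)
        (Finsupp.single (u * h b * Z (.ofAdd (w + z₁))) (1 : ℂ))) ξ =
        c₁ • leftTranslation u ξ := by
      intro b w
      rw [schurProduct_single, leftRegular_smul, _root_.smul_apply,
        leftRegular_single, (hc₁ b w w.2).2, one_smul, mul_assoc, leftTranslation_mul,
        hinv _ ⟨b, w, w.2, Or.inl rfl⟩]
    have e₂ : ∀ b, ∀ w : W, leftRegular (schurProduct (fun h : Λ => c h)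
        (Finsupp.single (u * h b * Z (.ofAdd (w + z₂))) (1 : ℂ))) ξ =
        c₂ • leftTranslation u ξ := by
      intro b w
      rw [schurProduct_single, leftRegular_smul, _root_.smul_apply,
        leftRegular_single, (hc₂ b w w.2).2, one_smul, mul_assoc, leftTranslation_mul,
        hinv _ ⟨b, w, w.2, Or.inr rfl⟩]
    rw [hf]
    simp only [schurProduct_sum, leftRegular_sum, _root_.sum_apply,
      schurProduct_sub, leftRegular_sub, _root_.sub_apply, e₁, e₂]
    simp only [Finset.sum_const, Finset.card_univ, ← sub_smul, ← Nat.cast_smul_eq_nsmul ℂ,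
      smul_smul, hN]
    push_cast
    ring_nf
  have hξn : 0 < ‖ξ‖ := norm_pos_iff.mpr hξ
  have h5 := (leftRegular (schurProduct (fun h : Λ => c h) f)).le_opNorm ξ
  rw [hval, norm_smul, LinearIsometry.norm_map, norm_mul, Complex.norm_real,
    Real.norm_of_nonneg hNpos.le] at h5
  have h6 := (le_of_mul_le_mul_right h5 hξn).trans hmain
  refine le_of_mul_le_mul_left (h6.trans (le_of_eq ?_)) hNpos
  ring

/-! ### Polynomials in `π⁻¹` -/

section Poly

variable {Fq : Type*} [Field Fq]

/-- The embedding of the polynomial ring in `F_q((π))` that sends the variable to `π⁻¹`. -/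
def polyEmb (Fq : Type*) [Field Fq] : Polynomial Fq →+* Fq⸨X⸩ :=
  (Polynomial.aeval (HahnSeries.single (-1 : ℤ) (1 : Fq))).toRingHom

theorem polyEmb_mem_polyInv (p : Polynomial Fq) : polyEmb Fq p ∈ polyInv Fq := by
  rw [polyInv, Algebra.adjoin_singleton_eq_range_aeval]
  exact ⟨p, rfl⟩

theorem polyEmb_coeff (p : Polynomial Fq) (n : ℕ) :
    (polyEmb Fq p).coeff (-(n : ℤ)) = p.coeff n := by
  induction p using Polynomial.induction_on' with
  | add p q hp hq => rw [map_add, HahnSeries.coeff_add, hp, hq, Polynomial.coeff_add]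
  | monomial k a =>
    have h : polyEmb Fq (Polynomial.monomial k a) = HahnSeries.single (-(k : ℤ)) a := by
      change Polynomial.aeval _ _ = _
      rw [Polynomial.aeval_monomial, HahnSeries.single_pow, LaurentSeries.algebraMap_apply,
        HahnSeries.C_mul_eq_smul]
      ext m
      simp [HahnSeries.coeff_single]
    rw [h, Polynomial.coeff_monomial, HahnSeries.coeff_single]
    simp [eq_comm]

theorem polyEmb_val_le_iff (p : Polynomial Fq) (n : ℕ) :
    Valued.v (polyEmb Fq p) ≤ WithZero.exp (n : ℤ) ↔ p.degree ≤ n := by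
  rw [← neg_neg (n : ℤ), LaurentSeries.valuation_le_iff_coeff_lt_eq_zero,
    Polynomial.degree_le_iff_coeff_zero]
  constructor
  · intro h m hm
    rw [← polyEmb_coeff]
    exact h _ (by have : n < m := by exact_mod_cast hm
                  omega)
  · intro h m hm
    obtain ⟨k, rfl⟩ : ∃ k : ℕ, m = -(k : ℤ) := ⟨(-m).toNat, by omega⟩
    rw [polyEmb_coeff]
    exact h k (by exact_mod_cast (by omega : n < k))

theorem polyEmb_val {p : Polynomial Fq} (hp : p ≠ 0) :
    Valued.v (polyEmb Fq p) = WithZero.exp (p.natDegree : ℤ) := by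
  refine le_antisymm ((polyEmb_val_le_iff p _).mpr Polynomial.degree_le_natDegree) ?_
  by_contra hlt
  rw [not_le, show (p.natDegree : ℤ) = p.natDegree - 1 + 1 by ring, WithZero.exp_add,
    WithZero.lt_mul_exp_iff_le (by simp)] at hlt
  have h := LaurentSeries.valuation_le_iff_coeff_lt_eq_zero Fq (D := -((p.natDegree : ℤ) - 1))
    (f := polyEmb Fq p)
  rw [neg_neg] at h
  have h0 := h.mp hlt (-(p.natDegree : ℤ)) (by omega)
  rw [polyEmb_coeff] at h0
  exact hp (Polynomial.leadingCoeff_eq_zero.mp h0)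

theorem polyEmb_val_lt {p : Polynomial Fq} {n : ℕ} (hp : p.degree < n) :
    Valued.v (polyEmb Fq p) < WithZero.exp (n : ℤ) := by
  rcases eq_or_ne p 0 with rfl | h
  · simp
  · rw [polyEmb_val h, WithZero.exp_lt_exp]
    exact_mod_cast (Polynomial.natDegree_lt_iff_degree_lt h).mpr hp

theorem polyEmb_val_eq {p : Polynomial Fq} {n : ℕ} (hp : p.degree = n) :
    Valued.v (polyEmb Fq p) = WithZero.exp (n : ℤ) := by
  have h0 : p ≠ 0 := by rintro rfl; simp at hp
  rw [polyEmb_val h0, Polynomial.natDegree_eq_of_degree_eq_some hp]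

instance degreeLT_finite [Finite Fq] (n : ℕ) : Finite (Polynomial.degreeLT Fq n) :=
  Finite.of_equiv _ (Polynomial.degreeLTEquiv Fq n).symm.toEquiv

theorem card_degreeLT [Finite Fq] (n : ℕ) :
    Nat.card (Polynomial.degreeLT Fq n) = Nat.card Fq ^ n := by
  rw [Nat.card_congr (Polynomial.degreeLTEquiv Fq n).toEquiv, Nat.card_fun]
  simp

end Poly

/-! ### Elements of `Sp₄` -/

section Sp

variable {R : Type*} [CommRing R]

theorem sympJ_mul_self : sympJ R * sympJ R = -1 := by
  ext i j
  fin_cases i <;> fin_cases j <;> simp [sympJ, Matrix.mul_apply, Fin.sum_univ_four]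

/-- The symplectic condition on a matrix says that its rows form a symplectic basis. -/
theorem symp_iff (A : Matrix (Fin 4) (Fin 4) R) :
    A * sympJ R * A.transpose = sympJ R ↔ ∀ i j, A i 0 * A j 3 + A i 1 * A j 2 -
      A i 2 * A j 1 - A i 3 * A j 0 = sympJ R i j := by
  rw [← Matrix.ext_iff]
  refine forall_congr' fun i => forall_congr' fun j => ?_
  have h : (A * sympJ R * A.transpose) i j = A i 0 * A j 3 + A i 1 * A j 2 -
      A i 2 * A j 1 - A i 3 * A j 0 := by
    simp [sympJ, Matrix.mul_apply, Fin.sum_univ_four]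
    ring
  rw [h]

/-- The element of `Sp₄(R)` with a given matrix. -/
def Sp4.ofMatrix (A : Matrix (Fin 4) (Fin 4) R) (h : A * sympJ R * A.transpose = sympJ R) :
    Sp4 R :=
  ⟨⟨A, -(sympJ R * A.transpose * sympJ R),
    by rw [mul_neg, ← mul_assoc, ← mul_assoc, h, sympJ_mul_self, neg_neg],
    by rw [mul_eq_one_comm, mul_neg, ← mul_assoc, ← mul_assoc, h, sympJ_mul_self,
        neg_neg]⟩, h⟩

theorem Sp4.ofMatrix_val (A : Matrix (Fin 4) (Fin 4) R)
    (h : A * sympJ R * A.transpose = sympJ R) : (Sp4.ofMatrix A h).1.val = A := rfl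

theorem Sp4.ext {A B : Sp4 R} (h : A.1.val = B.1.val) : A = B :=
  Subtype.ext (Units.ext h)

theorem Sp4.mul_val (A B : Sp4 R) : (A * B).1.val = A.1.val * B.1.val := rfl

theorem Sp4.one_val : (1 : Sp4 R).1.val = 1 := rfl

/-- A matrix is symplectic for its columns if it is symplectic for its rows. -/
theorem Sp4.columns (A : Sp4 R) (i j : Fin 4) : A.1.val 0 i * A.1.val 3 j +
    A.1.val 1 i * A.1.val 2 j - A.1.val 2 i * A.1.val 1 j - A.1.val 3 i * A.1.val 0 j =
    sympJ R i j := by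
  have h1 : A.1.val * -(sympJ R * A.1.val.transpose * sympJ R) = 1 := by
    rw [mul_neg, ← mul_assoc, ← mul_assoc, A.2, sympJ_mul_self, neg_neg]
  rw [mul_eq_one_comm] at h1
  have h2 : A.1.val.transpose * sympJ R * A.1.val = sympJ R := by
    calc A.1.val.transpose * sympJ R * A.1.val
        = -(sympJ R * sympJ R) * (A.1.val.transpose * sympJ R * A.1.val) := by
          rw [sympJ_mul_self, neg_neg, one_mul]
      _ = sympJ R * (-(sympJ R * A.1.val.transpose * sympJ R) * A.1.val) := by
          simp only [neg_mul, mul_neg, mul_assoc]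
      _ = sympJ R := by rw [h1, mul_one]
  have h3 := (symp_iff A.1.val.transpose).mp (by rw [Matrix.transpose_transpose]; exact h2) i j
  simpa only [Matrix.transpose_apply] using h3

theorem mem_Sp4Image {S : Type*} [CommRing S] {f : R →+* S} (hf : Function.Injective f)
    {A : Sp4 S} (h : ∀ i j, ∃ r, f r = A.1.val i j) : A ∈ Sp4Image f := by
  choose B hB using h
  have hBA : f.mapMatrix (Matrix.of B) = A.1.val := Matrix.ext hB
  have hJ : f.mapMatrix (sympJ R) = sympJ S := by
    ext i j
    fin_cases i <;> fin_cases j <;> simp [sympJ]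
  have hsymp : Matrix.of B * sympJ R * (Matrix.of B).transpose = sympJ R := by
    apply Matrix.map_injective hf
    change f.mapMatrix _ = f.mapMatrix _
    have ht : f.mapMatrix (Matrix.of B).transpose = (f.mapMatrix (Matrix.of B)).transpose := rfl
    rw [map_mul, map_mul, ht, hBA, hJ]
    exact A.2
  refine Subgroup.mem_subgroupOf.mpr ⟨(Sp4.ofMatrix _ hsymp).1, (Sp4.ofMatrix _ hsymp).2, ?_⟩
  exact Units.ext hBA

theorem exists_of_mem_Sp4Image {S : Type*} [CommRing S] {f : R →+* S} {A : Sp4 S}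
    (h : A ∈ Sp4Image f) (i j : Fin 4) : ∃ r, f r = A.1.val i j := by
  obtain ⟨B, -, hB⟩ := Subgroup.mem_subgroupOf.mp h
  exact ⟨B.val i j, congrArg (fun M : GL (Fin 4) S => M.val i j) hB⟩

/-- The element `(1 X; 0 1)` of the unipotent radical of the Siegel parabolic subgroup. -/
def siegel (a b d : R) : Sp4 R :=
  Sp4.ofMatrix !![1, 0, b, a; 0, 1, d, b; 0, 0, 1, 0; 0, 0, 0, 1] <| by
    rw [symp_iff]
    intro i j
    fin_cases i <;> fin_cases j <;> simp [sympJ]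

theorem siegel_mul (a b d a' b' d' : R) :
    siegel a b d * siegel a' b' d' = siegel (a + a') (b + b') (d + d') := by
  refine Sp4.ext (Matrix.ext fun i j => ?_)
  rw [Sp4.mul_val, Matrix.mul_apply, Fin.sum_univ_four]
  fin_cases i <;> fin_cases j <;> simp [siegel, Sp4.ofMatrix_val, add_comm]

/-- The elements of the Heisenberg group, the unipotent radical of the Klingen parabolic
subgroup. -/
def heisenberg (x y z : R) : Sp4 R :=
  Sp4.ofMatrix !![1, x, y, z; 0, 1, 0, y; 0, 0, 1, -x; 0, 0, 0, 1] <| by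
    rw [symp_iff]
    intro i j
    fin_cases i <;> fin_cases j <;> simp [sympJ]
    all_goals ring

theorem heisenberg_mul (x y z x' y' z' : R) : heisenberg x y z * heisenberg x' y' z' =
    heisenberg (x + x') (y + y') (z + z' + (x * y' - y * x')) := by
  refine Sp4.ext (Matrix.ext fun i j => ?_)
  rw [Sp4.mul_val, Matrix.mul_apply, Fin.sum_univ_four]
  fin_cases i <;> fin_cases j <;> simp [heisenberg, Sp4.ofMatrix_val] <;> ring

/-- The transposed Heisenberg group. -/
def lowerHeisenberg (x y z : R) : Sp4 R :=
  Sp4.ofMatrix !![1, 0, 0, 0; x, 1, 0, 0; y, 0, 1, 0; z, y, -x, 1] <| by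
    rw [symp_iff]
    intro i j
    fin_cases i <;> fin_cases j <;> simp [sympJ]
    all_goals ring

/-- The block diagonal matrix with blocks `t`, `(a b; c d)`, `t'`. -/
def blockDiag (t t' a b c d : R) (h : a * d - b * c = 1) (ht : t * t' = 1) : Sp4 R :=
  Sp4.ofMatrix !![t, 0, 0, 0; 0, a, b, 0; 0, c, d, 0; 0, 0, 0, t'] <| by
    rw [symp_iff]
    intro i j
    fin_cases i <;> fin_cases j <;> simp [sympJ] <;>
      first | ring1 | linear_combination h | linear_combination -h | linear_combination ht

/-- The Weyl element that exchanges the first two and the last two basis vectors. -/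
def weylSwap (R : Type*) [CommRing R] : Sp4 R :=
  Sp4.ofMatrix !![0, 1, 0, 0; 1, 0, 0, 0; 0, 0, 0, 1; 0, 0, 1, 0] <| by
    rw [symp_iff]
    intro i j
    fin_cases i <;> fin_cases j <;> simp [sympJ]

/-- The matrix of the symplectic form, as an element of `Sp₄(R)`. -/
def weylJ (R : Type*) [CommRing R] : Sp4 R :=
  Sp4.ofMatrix (sympJ R) <| by
    rw [symp_iff]
    intro i j
    fin_cases i <;> fin_cases j <;> simp [sympJ]

end Sp

section Membership

variable {Fq : Type*} [Field Fq]

theorem mem_SpK_iff {g : SpG Fq} : g ∈ SpK Fq ↔ ∀ i j, Valued.v (g.1.val i j) ≤ 1 := by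
  constructor
  · intro h i j
    obtain ⟨r, hr⟩ := exists_of_mem_Sp4Image h i j
    rw [LaurentSeries.val_le_one_iff_eq_coe]
    exact ⟨r, hr⟩
  · intro h
    refine mem_Sp4Image HahnSeries.ofPowerSeries_injective fun i j => ?_
    exact (LaurentSeries.val_le_one_iff_eq_coe Fq _).mp (h i j)

theorem mem_SpH {g : SpG Fq} (h : ∀ i j, ∃ p, g.1.val i j = polyEmb Fq p)
    (h' : g ∈ Sp4Unipotent Fq⸨X⸩) : g ∈ SpH Fq := by
  refine ⟨mem_Sp4Image Subtype.val_injective fun i j => ?_, h'⟩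
  obtain ⟨p, hp⟩ := h i j
  exact ⟨⟨_, polyEmb_mem_polyInv p⟩, hp.symm⟩

theorem siegel_mem_SpH (a b d : Polynomial Fq) :
    siegel (polyEmb Fq a) (polyEmb Fq b) (polyEmb Fq d) ∈ SpH Fq := by
  refine mem_SpH (fun i j => ?_) ⟨fun i j hij => ?_, fun i => ?_⟩
  · refine ⟨(siegel a b d).1.val i j, ?_⟩
    fin_cases i <;> fin_cases j <;> simp [siegel, Sp4.ofMatrix_val]
  · fin_cases i <;> fin_cases j <;> simp [siegel, Sp4.ofMatrix_val] at hij ⊢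
  · fin_cases i <;> simp [siegel, Sp4.ofMatrix_val]

theorem heisenberg_mem_SpH (x y z : Polynomial Fq) :
    heisenberg (polyEmb Fq x) (polyEmb Fq y) (polyEmb Fq z) ∈ SpH Fq := by
  refine mem_SpH (fun i j => ?_) ⟨fun i j hij => ?_, fun i => ?_⟩
  · refine ⟨(heisenberg x y z).1.val i j, ?_⟩
    fin_cases i <;> fin_cases j <;> simp [heisenberg, Sp4.ofMatrix_val]
  · fin_cases i <;> fin_cases j <;> simp [heisenberg, Sp4.ofMatrix_val] at hij ⊢
  · fin_cases i <;> simp [heisenberg, Sp4.ofMatrix_val]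

theorem blockDiag_mem_SpH (w : Polynomial Fq) :
    blockDiag 1 1 1 (polyEmb Fq w) 0 1 (by simp) (by simp) ∈ SpH Fq := by
  refine mem_SpH (fun i j => ?_) ⟨fun i j hij => ?_, fun i => ?_⟩
  · refine ⟨(blockDiag 1 1 1 w 0 1 (by simp) (by simp)).1.val i j, ?_⟩
    fin_cases i <;> fin_cases j <;> simp [blockDiag, Sp4.ofMatrix_val]
  · fin_cases i <;> fin_cases j <;> simp [blockDiag, Sp4.ofMatrix_val] at hij ⊢
  · fin_cases i <;> simp [blockDiag, Sp4.ofMatrix_val]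

end Membership

/-! ### The Cartan decomposition -/

section Cartan

variable {Fq : Type*} [Field Fq]

/-- `g` and `g'` lie in the same double coset of `K`. -/
def KEquiv (g g' : SpG Fq) : Prop := ∃ k ∈ SpK Fq, ∃ k' ∈ SpK Fq, k * g * k' = g'

theorem KEquiv.trans {g g' g'' : SpG Fq} (h : KEquiv g g') (h' : KEquiv g' g'') :
    KEquiv g g'' := by
  obtain ⟨k, hk, l, hl, rfl⟩ := h
  obtain ⟨k', hk', l', hl', rfl⟩ := h'
  exact ⟨k' * k, mul_mem hk' hk, l * l', mul_mem hl hl', by group⟩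

theorem KEquiv.mul_left {k g g' : SpG Fq} (hk : k ∈ SpK Fq) (h : KEquiv (k * g) g') :
    KEquiv g g' :=
  KEquiv.trans ⟨k, hk, 1, one_mem _, by group⟩ h

theorem KEquiv.mul_right {k g g' : SpG Fq} (hk : k ∈ SpK Fq) (h : KEquiv (g * k) g') :
    KEquiv g g' :=
  KEquiv.trans ⟨1, one_mem _, k, hk, by group⟩ h

theorem val_mul_le_of_mem_left {k g : SpG Fq} (hk : k ∈ SpK Fq) {r : WithZero (Multiplicative ℤ)}
    (hg : ∀ i j, Valued.v (g.1.val i j) ≤ r) (i j : Fin 4) :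
    Valued.v ((k * g).1.val i j) ≤ r := by
  rw [Sp4.mul_val, Matrix.mul_apply]
  refine Valuation.map_sum_le _ fun l _ => ?_
  rw [map_mul]
  exact (mul_le_mul' (mem_SpK_iff.mp hk i l) (hg l j)).trans (one_mul r).le

theorem val_mul_le_of_mem_right {k g : SpG Fq} (hk : k ∈ SpK Fq)
    {r : WithZero (Multiplicative ℤ)}
    (hg : ∀ i j, Valued.v (g.1.val i j) ≤ r) (i j : Fin 4) :
    Valued.v ((g * k).1.val i j) ≤ r := by
  rw [Sp4.mul_val, Matrix.mul_apply]
  refine Valuation.map_sum_le _ fun l _ => ?_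
  rw [map_mul]
  exact (mul_le_mul' (hg i l) (mem_SpK_iff.mp hk l j)).trans (mul_one r).le

theorem heisenberg_mem_SpK {x y z : Fq⸨X⸩} (hx : Valued.v x ≤ 1) (hy : Valued.v y ≤ 1)
    (hz : Valued.v z ≤ 1) : heisenberg x y z ∈ SpK Fq := by
  rw [mem_SpK_iff]
  intro i j
  fin_cases i <;> fin_cases j <;> simp [heisenberg, Sp4.ofMatrix_val, Valuation.map_neg, hx, hy, hz]

theorem lowerHeisenberg_mem_SpK {x y z : Fq⸨X⸩} (hx : Valued.v x ≤ 1) (hy : Valued.v y ≤ 1)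
    (hz : Valued.v z ≤ 1) : lowerHeisenberg x y z ∈ SpK Fq := by
  rw [mem_SpK_iff]
  intro i j
  fin_cases i <;> fin_cases j <;>
    simp [lowerHeisenberg, Sp4.ofMatrix_val, Valuation.map_neg, hx, hy, hz]

theorem blockDiag_mem_SpK {t t' a b c d : Fq⸨X⸩} (h : a * d - b * c = 1) (h' : t * t' = 1)
    (ht : Valued.v t ≤ 1) (ht' : Valued.v t' ≤ 1) (ha : Valued.v a ≤ 1) (hb : Valued.v b ≤ 1)
    (hc : Valued.v c ≤ 1) (hd : Valued.v d ≤ 1) : blockDiag t t' a b c d h h' ∈ SpK Fq := by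
  rw [mem_SpK_iff]
  intro i j
  fin_cases i <;> fin_cases j <;> simp [blockDiag, Sp4.ofMatrix_val, ht, ht', ha, hb, hc, hd]

theorem weylSwap_mem_SpK : weylSwap Fq⸨X⸩ ∈ SpK Fq := by
  rw [mem_SpK_iff]
  intro i j
  fin_cases i <;> fin_cases j <;> simp [weylSwap, Sp4.ofMatrix_val]

theorem weylJ_mem_SpK : weylJ Fq⸨X⸩ ∈ SpK Fq := by
  rw [mem_SpK_iff]
  intro i j
  fin_cases i <;> fin_cases j <;> simp [weylJ, sympJ, Sp4.ofMatrix_val, Valuation.map_neg]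

theorem blockDiag_mul {R : Type*} [CommRing R] {t t' a b c d s s' a' b' c' d' : R}
    (h : a * d - b * c = 1) (ht : t * t' = 1) (h' : a' * d' - b' * c' = 1) (hs : s * s' = 1) :
    blockDiag t t' a b c d h ht * blockDiag s s' a' b' c' d' h' hs =
      blockDiag (t * s) (t' * s') (a * a' + b * c') (a * b' + b * d') (c * a' + d * c')
        (c * b' + d * d') (by linear_combination (a' * d' - b' * c') * h + h')
        (by linear_combination s * s' * ht + hs) := by
  refine Sp4.ext (Matrix.ext fun i j => ?_)
  rw [Sp4.mul_val, Matrix.mul_apply, Fin.sum_univ_four]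
  fin_cases i <;> fin_cases j <;> simp [blockDiag, Sp4.ofMatrix_val]

theorem blockDiag_congr {R : Type*} [CommRing R] {t t' a b c d s s' a' b' c' d' : R}
    (h : a * d - b * c = 1) (ht : t * t' = 1) (h' : a' * d' - b' * c' = 1) (hs : s * s' = 1)
    (h₁ : t = s) (h₂ : t' = s') (h₃ : a = a') (h₄ : b = b') (h₅ : c = c') (h₆ : d = d') :
    blockDiag t t' a b c d h ht = blockDiag s s' a' b' c' d' h' hs := by
  subst h₁ h₂ h₃ h₄ h₅ h₆
  rfl

theorem ne_zero_of_val_eq_exp {x : Fq⸨X⸩} {n : ℤ} (hx : Valued.v x = WithZero.exp n) :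
    x ≠ 0 := by
  rintro rfl
  rw [map_zero] at hx
  exact WithZero.exp_ne_zero hx.symm

theorem val_div_le_one {x t : Fq⸨X⸩} (h : Valued.v x ≤ Valued.v t) :
    Valued.v (x / t) ≤ 1 := by
  rw [map_div₀]
  exact div_le_one_of_le₀ h zero_le

/-- Gaussian elimination with the first diagonal entry as pivot. -/
theorem kEquiv_blockDiag_of_pivot (g : SpG Fq) (ht : g.1.val 0 0 ≠ 0)
    (hg : ∀ i j, Valued.v (g.1.val i j) ≤ Valued.v (g.1.val 0 0)) :
    ∃ h, KEquiv g (blockDiag (g.1.val 0 0) (g.1.val 0 0)⁻¹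
      (g.1.val 1 1 - g.1.val 1 0 * g.1.val 0 1 / g.1.val 0 0)
      (g.1.val 1 2 - g.1.val 1 0 * g.1.val 0 2 / g.1.val 0 0)
      (g.1.val 2 1 - g.1.val 2 0 * g.1.val 0 1 / g.1.val 0 0)
      (g.1.val 2 2 - g.1.val 2 0 * g.1.val 0 2 / g.1.val 0 0) h (mul_inv_cancel₀ ht)) := by
  have hk := lowerHeisenberg_mem_SpK (x := -(g.1.val 1 0 / g.1.val 0 0))
    (y := -(g.1.val 2 0 / g.1.val 0 0)) (z := -(g.1.val 3 0 / g.1.val 0 0))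
    (by rw [Valuation.map_neg]; exact val_div_le_one (hg _ _))
    (by rw [Valuation.map_neg]; exact val_div_le_one (hg _ _))
    (by rw [Valuation.map_neg]; exact val_div_le_one (hg _ _))
  have hk' := heisenberg_mem_SpK (x := -(g.1.val 0 1 / g.1.val 0 0))
    (y := -(g.1.val 0 2 / g.1.val 0 0)) (z := -(g.1.val 0 3 / g.1.val 0 0))
    (by rw [Valuation.map_neg]; exact val_div_le_one (hg _ _))
    (by rw [Valuation.map_neg]; exact val_div_le_one (hg _ _))
    (by rw [Valuation.map_neg]; exact val_div_le_one (hg _ _))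
  set k := lowerHeisenberg (-(g.1.val 1 0 / g.1.val 0 0)) (-(g.1.val 2 0 / g.1.val 0 0))
    (-(g.1.val 3 0 / g.1.val 0 0)) with hkdef
  set k' := heisenberg (-(g.1.val 0 1 / g.1.val 0 0)) (-(g.1.val 0 2 / g.1.val 0 0))
    (-(g.1.val 0 3 / g.1.val 0 0)) with hkdef'
  set M := k * g * k' with hM
  have hMv : ∀ i j, M.1.val i j = ∑ l, (∑ m, k.1.val i m * g.1.val m l) * k'.1.val l j := by
    intro i j
    rw [hM, Sp4.mul_val, Sp4.mul_val, Matrix.mul_apply]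
    simp only [Matrix.mul_apply]
  have h00 : M.1.val 0 0 = g.1.val 0 0 := by
    rw [hMv]; simp [Fin.sum_univ_four, hkdef, hkdef', lowerHeisenberg, heisenberg, Sp4.ofMatrix_val]
  have h10 : M.1.val 1 0 = 0 := by
    rw [hMv]; simp [Fin.sum_univ_four, hkdef, hkdef', lowerHeisenberg, heisenberg, Sp4.ofMatrix_val]
    field_simp; ring
  have h20 : M.1.val 2 0 = 0 := by
    rw [hMv]; simp [Fin.sum_univ_four, hkdef, hkdef', lowerHeisenberg, heisenberg, Sp4.ofMatrix_val]
    field_simp; ring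
  have h30 : M.1.val 3 0 = 0 := by
    rw [hMv]; simp [Fin.sum_univ_four, hkdef, hkdef', lowerHeisenberg, heisenberg, Sp4.ofMatrix_val]
    field_simp; ring
  have h01 : M.1.val 0 1 = 0 := by
    rw [hMv]; simp [Fin.sum_univ_four, hkdef, hkdef', lowerHeisenberg, heisenberg, Sp4.ofMatrix_val]
    field_simp; ring
  have h02 : M.1.val 0 2 = 0 := by
    rw [hMv]; simp [Fin.sum_univ_four, hkdef, hkdef', lowerHeisenberg, heisenberg, Sp4.ofMatrix_val]
    field_simp; ring
  have h03 : M.1.val 0 3 = 0 := by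
    rw [hMv]; simp [Fin.sum_univ_four, hkdef, hkdef', lowerHeisenberg, heisenberg, Sp4.ofMatrix_val]
    field_simp; ring
  have h11 : M.1.val 1 1 = g.1.val 1 1 - g.1.val 1 0 * g.1.val 0 1 / g.1.val 0 0 := by
    rw [hMv]; simp [Fin.sum_univ_four, hkdef, hkdef', lowerHeisenberg, heisenberg, Sp4.ofMatrix_val]
    field_simp; ring
  have h12 : M.1.val 1 2 = g.1.val 1 2 - g.1.val 1 0 * g.1.val 0 2 / g.1.val 0 0 := by
    rw [hMv]; simp [Fin.sum_univ_four, hkdef, hkdef', lowerHeisenberg, heisenberg, Sp4.ofMatrix_val]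
    field_simp; ring
  have h21 : M.1.val 2 1 = g.1.val 2 1 - g.1.val 2 0 * g.1.val 0 1 / g.1.val 0 0 := by
    rw [hMv]; simp [Fin.sum_univ_four, hkdef, hkdef', lowerHeisenberg, heisenberg, Sp4.ofMatrix_val]
    field_simp; ring
  have h22 : M.1.val 2 2 = g.1.val 2 2 - g.1.val 2 0 * g.1.val 0 2 / g.1.val 0 0 := by
    rw [hMv]; simp [Fin.sum_univ_four, hkdef, hkdef', lowerHeisenberg, heisenberg, Sp4.ofMatrix_val]
    field_simp; ring
  -- the symplectic relations determine the last row and the last column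
  have hr := (symp_iff M.1.val).mp M.2
  have hc := Sp4.columns M
  have h33 : M.1.val 3 3 = (g.1.val 0 0)⁻¹ := by
    have := hr 0 3
    simp only [h00, h01, h02, h03, sympJ] at this
    simp at this
    exact eq_inv_of_mul_eq_one_right this
  have hrow : ∀ j, (sympJ Fq⸨X⸩) 0 j = 0 → M.1.val j 3 = 0 ∧ M.1.val 3 j = 0 := by
    intro j hj
    have e₁ := hr 0 j
    have e₂ := hc 0 j
    rw [hj, h00] at e₁ e₂
    simp only [h10, h20, h30, h01, h02, h03] at e₁ e₂
    simp [ht] at e₁ e₂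
    exact ⟨e₁, e₂⟩
  obtain ⟨h13, h31⟩ := hrow 1 (by simp [sympJ])
  obtain ⟨h23, h32⟩ := hrow 2 (by simp [sympJ])
  have hdet := hr 1 2
  simp only [h10, h20, h11, h12, h21, h22, sympJ] at hdet
  simp at hdet
  refine ⟨hdet, k, hk, k', hk', Sp4.ext (Matrix.ext fun i j => ?_)⟩
  change M.1.val i j = _
  fin_cases i <;> fin_cases j <;>
    simp [blockDiag, Sp4.ofMatrix_val, h00, h01, h02, h03, h10, h20, h30, h11, h12, h21, h22,
      h13, h31, h23, h32, h33]

theorem single_mul_single_neg (n : ℕ) :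
    (HahnSeries.single (-(n : ℤ)) 1 : Fq⸨X⸩) * HahnSeries.single (n : ℤ) 1 = 1 := by
  rw [HahnSeries.single_mul_single]
  simp

/-- The diagonal matrix `(π⁻ⁱ, π⁻ʲ, πʲ, πⁱ)`; those with `j ≤ i` represent the double cosets
of `K`. -/
def cartan (Fq : Type*) [Field Fq] (i j : ℕ) : SpG Fq :=
  blockDiag (HahnSeries.single (-(i : ℤ)) 1) (HahnSeries.single (i : ℤ) 1)
    (HahnSeries.single (-(j : ℤ)) 1) 0 0 (HahnSeries.single (j : ℤ) 1)
    (by rw [single_mul_single_neg]; simp) (single_mul_single_neg i)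

/-- Cartan decomposition in the block diagonal subgroup, when the largest entry of the `SL₂` block
is the first one. -/
theorem kEquiv_cartan_of_first {t t' a b c d : Fq⸨X⸩} (h : a * d - b * c = 1) (h' : t * t' = 1)
    {i j : ℕ} (ht : Valued.v t = WithZero.exp (i : ℤ)) (ha : Valued.v a = WithZero.exp (j : ℤ))
    (hb : Valued.v b ≤ WithZero.exp (j : ℤ)) (hc : Valued.v c ≤ WithZero.exp (j : ℤ)) :
    KEquiv (blockDiag t t' a b c d h h') (cartan Fq i j) := by
  have ha0 : a ≠ 0 := ne_zero_of_val_eq_exp ha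
  have ht0 : t ≠ 0 := ne_zero_of_val_eq_exp ht
  have hs : ∀ n : ℕ, (HahnSeries.single (-(n : ℤ)) 1 : Fq⸨X⸩) ≠ 0 := fun n => by simp
  have hv : ∀ n : ℕ, Valued.v (HahnSeries.single (-(n : ℤ)) 1 : Fq⸨X⸩) =
      WithZero.exp (n : ℤ) := fun n => by rw [LaurentSeries.valuation_single_zpow, neg_neg]
  have hs' : ∀ n : ℕ, (HahnSeries.single (n : ℤ) 1 : Fq⸨X⸩) =
      (HahnSeries.single (-(n : ℤ)) 1)⁻¹ := fun n =>
    eq_inv_of_mul_eq_one_right (single_mul_single_neg n)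
  set p : Fq⸨X⸩ := HahnSeries.single (-(i : ℤ)) 1 with hp
  set r : Fq⸨X⸩ := HahnSeries.single (-(j : ℤ)) 1 with hr
  have hp0 : p ≠ 0 := hs i
  have hr0 : r ≠ 0 := hs j
  have e1 : ∀ {x y : Fq⸨X⸩} {n : ℕ}, Valued.v x = WithZero.exp (n : ℤ) →
      Valued.v y = WithZero.exp (n : ℤ) → Valued.v (x / y) ≤ 1 := by
    intro x y n hx hy
    rw [map_div₀, hx, hy, div_self WithZero.exp_ne_zero]
  refine ⟨blockDiag (p / t) (t / p) (r / a) 0 0 (a / r) (by field_simp; ring) (by field_simp) *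
    blockDiag 1 1 1 0 (-(c / a)) 1 (by ring) (by ring), mul_mem ?_ ?_,
    blockDiag 1 1 1 (-(b / a)) 0 1 (by ring) (by ring), ?_, ?_⟩
  · exact blockDiag_mem_SpK _ _ (e1 (hv i) ht) (e1 ht (hv i)) (e1 (hv j) ha) (by simp) (by simp)
      (e1 ha (hv j))
  · refine blockDiag_mem_SpK _ _ (by simp) (by simp) (by simp) (by simp) ?_ (by simp)
    rw [Valuation.map_neg]
    exact val_div_le_one (ha ▸ hc)
  · refine blockDiag_mem_SpK _ _ (by simp) (by simp) (by simp) ?_ (by simp) (by simp)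
    rw [Valuation.map_neg]
    exact val_div_le_one (ha ▸ hb)
  · have ht' : t' = t⁻¹ := eq_inv_of_mul_eq_one_right h'
    have hd : d = (1 + b * c) / a := by
      rw [eq_div_iff ha0]
      linear_combination h
    rw [cartan, blockDiag_mul, blockDiag_mul, blockDiag_mul]
    refine blockDiag_congr _ _ _ _ ?_ ?_ ?_ ?_ ?_ ?_
    · field_simp
      rw [hp]
    · rw [hs', ← hp, ht']
      field_simp
    · field_simp
      rw [← hr]
      ring
    · field_simp
      ring
    · field_simp
      ring
    · rw [hs', ← hr, hd]
      field_simp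
      ring

/-- Cartan decomposition in the block diagonal subgroup. -/
theorem kEquiv_cartan_of_blockDiag {t t' a b c d : Fq⸨X⸩} (h : a * d - b * c = 1)
    (h' : t * t' = 1) {i j : ℕ} (ht : Valued.v t = WithZero.exp (i : ℤ))
    (ha : Valued.v a ≤ WithZero.exp (j : ℤ)) (hb : Valued.v b ≤ WithZero.exp (j : ℤ))
    (hc : Valued.v c ≤ WithZero.exp (j : ℤ)) (hd : Valued.v d ≤ WithZero.exp (j : ℤ))
    (hmax : Valued.v a = WithZero.exp (j : ℤ) ∨ Valued.v b = WithZero.exp (j : ℤ) ∨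
      Valued.v c = WithZero.exp (j : ℤ) ∨ Valued.v d = WithZero.exp (j : ℤ)) :
    KEquiv (blockDiag t t' a b c d h h') (cartan Fq i j) := by
  -- the nontrivial Weyl element of `SL₂` moves every entry to the first place
  have hw : blockDiag 1 1 0 1 (-1) 0 (by ring) (by ring) ∈ SpK Fq :=
    blockDiag_mem_SpK _ _ (by simp) (by simp) (by simp) (by simp) (by simp [Valuation.map_neg])
      (by simp)
  have hl : ∀ {a b c d : Fq⸨X⸩} (h : a * d - b * c = 1),
      blockDiag 1 1 0 1 (-1) 0 (by ring) (by ring) * blockDiag t t' a b c d h h' =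
        blockDiag t t' c d (-a) (-b) (by linear_combination h) h' := by
    intro a b c d h
    rw [blockDiag_mul]
    exact blockDiag_congr _ _ _ _ (by ring) (by ring) (by ring) (by ring) (by ring) (by ring)
  have hr : ∀ {a b c d : Fq⸨X⸩} (h : a * d - b * c = 1),
      blockDiag t t' a b c d h h' * blockDiag 1 1 0 1 (-1) 0 (by ring) (by ring) =
        blockDiag t t' (-b) a (-d) c (by linear_combination h) h' := by
    intro a b c d h
    rw [blockDiag_mul]
    exact blockDiag_congr _ _ _ _ (by ring) (by ring) (by ring) (by ring) (by ring) (by ring)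
  rcases hmax with hm | hm | hm | hm
  · exact kEquiv_cartan_of_first h h' ht hm hb hc
  · refine KEquiv.mul_right hw ?_
    rw [hr]
    exact kEquiv_cartan_of_first _ h' ht (by rw [Valuation.map_neg, hm]) ha
      (by rwa [Valuation.map_neg])
  · refine KEquiv.mul_left hw ?_
    rw [hl]
    exact kEquiv_cartan_of_first _ h' ht hm hd (by rwa [Valuation.map_neg])
  · refine KEquiv.mul_left hw ?_
    rw [hl]
    refine KEquiv.mul_right hw ?_
    rw [hr]
    exact kEquiv_cartan_of_first _ h' ht (by rw [Valuation.map_neg, hm]) hc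
      (by rwa [neg_neg])

/-- The double coset of an element whose largest entry is the one in the upper right corner. -/
theorem kEquiv_cartan_of_corner (g : SpG Fq) {i j : ℕ}
    (hz : Valued.v (g.1.val 0 3) = WithZero.exp (i : ℤ))
    (hg : ∀ k l, Valued.v (g.1.val k l) ≤ WithZero.exp (i : ℤ))
    (h₁₁ : Valued.v (g.1.val 1 1 - g.1.val 1 3 * g.1.val 0 1 / g.1.val 0 3) ≤
      WithZero.exp (j : ℤ))
    (h₁₂ : Valued.v (g.1.val 1 2 - g.1.val 1 3 * g.1.val 0 2 / g.1.val 0 3) ≤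
      WithZero.exp (j : ℤ))
    (h₂₁ : Valued.v (g.1.val 2 1 - g.1.val 2 3 * g.1.val 0 1 / g.1.val 0 3) ≤
      WithZero.exp (j : ℤ))
    (h₂₂ : Valued.v (g.1.val 2 2 - g.1.val 2 3 * g.1.val 0 2 / g.1.val 0 3) ≤
      WithZero.exp (j : ℤ))
    (hmax : Valued.v (g.1.val 1 1 - g.1.val 1 3 * g.1.val 0 1 / g.1.val 0 3) =
        WithZero.exp (j : ℤ) ∨
      Valued.v (g.1.val 1 2 - g.1.val 1 3 * g.1.val 0 2 / g.1.val 0 3) = WithZero.exp (j : ℤ)) :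
    KEquiv g (cartan Fq i j) := by
  have hcol : ∀ k, (g * weylJ Fq⸨X⸩).1.val k 0 = -g.1.val k 3 ∧
      (g * weylJ Fq⸨X⸩).1.val k 1 = -g.1.val k 2 ∧ (g * weylJ Fq⸨X⸩).1.val k 2 = g.1.val k 1 := by
    intro k
    rw [Sp4.mul_val]
    simp [Matrix.mul_apply, Fin.sum_univ_four, weylJ, Sp4.ofMatrix_val, sympJ]
  have h00 : Valued.v ((g * weylJ Fq⸨X⸩).1.val 0 0) = WithZero.exp (i : ℤ) := by
    rw [(hcol 0).1, Valuation.map_neg, hz]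
  obtain ⟨h, hk⟩ := kEquiv_blockDiag_of_pivot (g * weylJ Fq⸨X⸩)
    (ne_zero_of_val_eq_exp h00)
    (fun k l => h00 ▸ val_mul_le_of_mem_right weylJ_mem_SpK hg k l)
  refine KEquiv.mul_right weylJ_mem_SpK (hk.trans ?_)
  have e₁ : ∀ k, (g * weylJ Fq⸨X⸩).1.val k 1 - (g * weylJ Fq⸨X⸩).1.val k 0 *
      (g * weylJ Fq⸨X⸩).1.val 0 1 / (g * weylJ Fq⸨X⸩).1.val 0 0 =
      -(g.1.val k 2 - g.1.val k 3 * g.1.val 0 2 / g.1.val 0 3) := by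
    intro k
    rw [(hcol k).1, (hcol k).2.1, (hcol 0).1, (hcol 0).2.1]
    ring
  have e₂ : ∀ k, (g * weylJ Fq⸨X⸩).1.val k 2 - (g * weylJ Fq⸨X⸩).1.val k 0 *
      (g * weylJ Fq⸨X⸩).1.val 0 2 / (g * weylJ Fq⸨X⸩).1.val 0 0 =
      g.1.val k 1 - g.1.val k 3 * g.1.val 0 1 / g.1.val 0 3 := by
    intro k
    rw [(hcol k).1, (hcol k).2.2, (hcol 0).1, (hcol 0).2.2]
    ring
  apply kEquiv_cartan_of_blockDiag _ _ h00
  · rwa [e₁, Valuation.map_neg]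
  · rwa [e₂]
  · rwa [e₁, Valuation.map_neg]
  · rwa [e₂]
  · rw [e₁, e₂, Valuation.map_neg]
    tauto

theorem exists_row_to_first (g : SpG Fq) (p : Fin 4) :
    ∃ k ∈ SpK Fq, ∀ l, Valued.v ((k * g).1.val 0 l) = Valued.v (g.1.val p l) := by
  have hs : ∀ g : SpG Fq, ∀ l, (weylSwap Fq⸨X⸩ * g).1.val 0 l = g.1.val 1 l := by
    intro g l
    rw [Sp4.mul_val]
    simp [Matrix.mul_apply, Fin.sum_univ_four, weylSwap, Sp4.ofMatrix_val]
  have hJ : ∀ g : SpG Fq, ∀ l, (weylJ Fq⸨X⸩ * g).1.val 0 l = g.1.val 3 l ∧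
      (weylJ Fq⸨X⸩ * g).1.val 1 l = g.1.val 2 l := by
    intro g l
    rw [Sp4.mul_val]
    simp [Matrix.mul_apply, Fin.sum_univ_four, weylJ, sympJ, Sp4.ofMatrix_val]
  fin_cases p
  · exact ⟨1, one_mem _, fun l => by simp⟩
  · exact ⟨_, weylSwap_mem_SpK, fun l => by rw [hs]; rfl⟩
  · exact ⟨_, mul_mem weylSwap_mem_SpK weylJ_mem_SpK,
      fun l => by rw [mul_assoc, hs, (hJ g l).2]; rfl⟩
  · exact ⟨_, weylJ_mem_SpK, fun l => by rw [(hJ g l).1]; rfl⟩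

theorem exists_column_to_first (g : SpG Fq) (p : Fin 4) :
    ∃ k ∈ SpK Fq, ∀ l, Valued.v ((g * k).1.val l 0) = Valued.v (g.1.val l p) := by
  have hs : ∀ g : SpG Fq, ∀ l, (g * weylSwap Fq⸨X⸩).1.val l 0 = g.1.val l 1 := by
    intro g l
    rw [Sp4.mul_val]
    simp [Matrix.mul_apply, Fin.sum_univ_four, weylSwap, Sp4.ofMatrix_val]
  have hJ : ∀ g : SpG Fq, ∀ l, (g * weylJ Fq⸨X⸩).1.val l 0 = -g.1.val l 3 ∧
      (g * weylJ Fq⸨X⸩).1.val l 1 = -g.1.val l 2 := by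
    intro g l
    rw [Sp4.mul_val]
    simp [Matrix.mul_apply, Fin.sum_univ_four, weylJ, sympJ, Sp4.ofMatrix_val]
  fin_cases p
  · exact ⟨1, one_mem _, fun l => by simp⟩
  · exact ⟨_, weylSwap_mem_SpK, fun l => by rw [hs]; rfl⟩
  · exact ⟨_, mul_mem weylJ_mem_SpK weylSwap_mem_SpK,
      fun l => by rw [← mul_assoc, hs, (hJ g l).2, Valuation.map_neg]; rfl⟩
  · exact ⟨_, weylJ_mem_SpK, fun l => by rw [(hJ g l).1, Valuation.map_neg]; rfl⟩

theorem exists_val_eq_exp {x : Fq⸨X⸩} (hx : 1 ≤ Valued.v x) :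
    ∃ n : ℕ, Valued.v x = WithZero.exp (n : ℤ) := by
  have h0 : Valued.v x ≠ 0 := (zero_lt_one.trans_le hx).ne'
  rw [← WithZero.exp_log h0, ← WithZero.exp_zero, WithZero.exp_le_exp] at hx
  obtain ⟨n, hn⟩ := Int.eq_ofNat_of_zero_le hx
  exact ⟨n, by rw [← WithZero.exp_log h0, hn]⟩

theorem not_forall_val_lt_one {a b c d : Fq⸨X⸩} (h : a * d - b * c = 1) (ha : Valued.v a < 1)
    (hb : Valued.v b < 1) (hc : Valued.v c < 1) (hd : Valued.v d < 1) : False := by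
  have h1 : Valued.v (a * d - b * c) < 1 := by
    refine Valuation.map_sub_lt _ ?_ ?_
    · rw [map_mul]
      exact mul_lt_one' ha hd
    · rw [map_mul]
      exact mul_lt_one' hb hc
  rw [h, map_one] at h1
  exact lt_irrefl _ h1

theorem exists_kEquiv_cartan_of_blockDiag {t t' a b c d : Fq⸨X⸩} (h : a * d - b * c = 1)
    (h' : t * t' = 1) {n : ℕ} (ht : Valued.v t = WithZero.exp (n : ℤ))
    (ha : Valued.v a ≤ WithZero.exp (n : ℤ)) (hb : Valued.v b ≤ WithZero.exp (n : ℤ))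
    (hc : Valued.v c ≤ WithZero.exp (n : ℤ)) (hd : Valued.v d ≤ WithZero.exp (n : ℤ)) :
    ∃ j ≤ n, KEquiv (blockDiag t t' a b c d h h') (cartan Fq n j) := by
  have key : ∀ m, Valued.v a ≤ Valued.v m → Valued.v b ≤ Valued.v m →
      Valued.v c ≤ Valued.v m → Valued.v d ≤ Valued.v m → Valued.v m ≤ WithZero.exp (n : ℤ) →
      (m = a ∨ m = b ∨ m = c ∨ m = d) →
      ∃ j ≤ n, KEquiv (blockDiag t t' a b c d h h') (cartan Fq n j) := by
    intro m h₁ h₂ h₃ h₄ hmn hm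
    have h1 : 1 ≤ Valued.v m := by
      by_contra hlt
      rw [not_le] at hlt
      exact not_forall_val_lt_one h (h₁.trans_lt hlt) (h₂.trans_lt hlt) (h₃.trans_lt hlt)
        (h₄.trans_lt hlt)
    obtain ⟨j, hj⟩ := exists_val_eq_exp h1
    rw [hj] at h₁ h₂ h₃ h₄ hmn
    rw [WithZero.exp_le_exp] at hmn
    refine ⟨j, by exact_mod_cast hmn, kEquiv_cartan_of_blockDiag h h' ht h₁ h₂ h₃ h₄ ?_⟩
    rcases hm with rfl | rfl | rfl | rfl <;> simp [hj]
  obtain ⟨m, hm⟩ := Finite.exists_max fun x : Fin 4 => Valued.v (![a, b, c, d] x)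
  refine key (![a, b, c, d] m) (hm 0) (hm 1) (hm 2) (hm 3) ?_ ?_
  · fin_cases m
    exacts [ha, hb, hc, hd]
  · fin_cases m <;> simp

theorem exists_max_entry (g : SpG Fq) : ∃ n : ℕ,
    (∀ k l, Valued.v (g.1.val k l) ≤ WithZero.exp (n : ℤ)) ∧
      ∃ k l, Valued.v (g.1.val k l) = WithZero.exp (n : ℤ) := by
  obtain ⟨⟨p, q⟩, hpq⟩ := Finite.exists_max fun x : Fin 4 × Fin 4 => Valued.v (g.1.val x.1 x.2)
  have h1 : 1 ≤ Valued.v (g.1.val p q) := by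
    by_contra hlt
    rw [not_le] at hlt
    have hlt' : ∀ k l, Valued.v (g.1.val k l) < 1 := fun k l => (hpq (k, l)).trans_lt hlt
    have h := (symp_iff g.1.val).mp g.2 0 3
    have h2 : Valued.v ((1 : Fq⸨X⸩)) < 1 := by
      have hJ : sympJ Fq⸨X⸩ 0 3 = 1 := by simp [sympJ]
      rw [← hJ, ← h]
      refine Valuation.map_sub_lt _ (Valuation.map_sub_lt _ (Valuation.map_add_lt _ ?_ ?_) ?_) ?_
      all_goals
        rw [map_mul]
        exact mul_lt_one' (hlt' _ _) (hlt' _ _)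
    rw [map_one] at h2
    exact lt_irrefl _ h2
  obtain ⟨n, hn⟩ := exists_val_eq_exp h1
  exact ⟨n, fun k l => hn ▸ hpq (k, l), p, q, hn⟩

theorem exists_kEquiv_cartan_of_pivot (M : SpG Fq) {n : ℕ}
    (hM : ∀ k l, Valued.v (M.1.val k l) ≤ WithZero.exp (n : ℤ))
    (h00 : Valued.v (M.1.val 0 0) = WithZero.exp (n : ℤ)) :
    ∃ j ≤ n, KEquiv M (cartan Fq n j) := by
  have ht := ne_zero_of_val_eq_exp h00
  have hdiv : ∀ s, Valued.v (M.1.val 0 s / M.1.val 0 0) ≤ 1 :=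
    fun s => val_div_le_one (h00 ▸ hM 0 s)
  have hS : ∀ r s, Valued.v (M.1.val r s - M.1.val r 0 * M.1.val 0 s / M.1.val 0 0) ≤
      WithZero.exp (n : ℤ) := by
    intro r s
    refine Valuation.map_sub_le _ (hM r s) ?_
    rw [mul_div_assoc, map_mul]
    exact (mul_le_mul' (hM r 0) (hdiv s)).trans (mul_one _).le
  obtain ⟨hdet, hKE⟩ := kEquiv_blockDiag_of_pivot M ht (fun i j => h00 ▸ hM i j)
  obtain ⟨j, hj, hjK⟩ := exists_kEquiv_cartan_of_blockDiag hdet (mul_inv_cancel₀ ht) h00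
    (hS 1 1) (hS 1 2) (hS 2 1) (hS 2 2)
  exact ⟨j, hj, hKE.trans hjK⟩

/-- The Cartan decomposition `G = K A⁺ K`, where the first exponent is read off from the largest
entry. -/
theorem exists_kEquiv_cartan (g : SpG Fq) {n : ℕ}
    (hg : ∀ k l, Valued.v (g.1.val k l) ≤ WithZero.exp (n : ℤ))
    (hg' : ∃ k l, Valued.v (g.1.val k l) = WithZero.exp (n : ℤ)) :
    ∃ j ≤ n, KEquiv g (cartan Fq n j) := by
  obtain ⟨p, q, hpq⟩ := hg'
  obtain ⟨k, hk, hkg⟩ := exists_row_to_first g p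
  obtain ⟨k', hk', hkg'⟩ := exists_column_to_first (k * g) q
  obtain ⟨j, hj, hjK⟩ := exists_kEquiv_cartan_of_pivot (k * g * k')
    (val_mul_le_of_mem_right hk' (val_mul_le_of_mem_left hk hg))
    ((hkg' 0).trans ((hkg q).trans hpq))
  exact ⟨j, hj, KEquiv.trans ⟨k, hk, k', hk', rfl⟩ hjK⟩

end Cartan

/-! ### Quotients of polynomials -/

section Quotients

variable {Fq : Type*} [Field Fq]

theorem div_mem_degreeLT {p t : Polynomial Fq} {n : ℕ} (ht : t ≠ 0)
    (h : p.degree < n + t.degree) : p / t ∈ Polynomial.degreeLT Fq n := by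
  rw [Polynomial.mem_degreeLT]
  rcases lt_or_ge p.degree t.degree with hlt | hle
  · rw [(Polynomial.div_eq_zero_iff ht).mpr hlt, Polynomial.degree_zero]
    exact WithBot.bot_lt_coe n
  · rw [← Polynomial.degree_add_div ht hle, add_comm] at h
    exact lt_of_add_lt_add_right h

/-- The additive map `p ↦ ⌊p / X ^ i⌋`. -/
def divXPow (Fq : Type*) [Field Fq] (i : ℕ) : Polynomial Fq →+ Polynomial Fq :=
  AddMonoidHom.mk' (fun p => p / Polynomial.X ^ i) fun p q => by
    have h0 : (Polynomial.X ^ i : Polynomial Fq) ≠ 0 := pow_ne_zero _ Polynomial.X_ne_zero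
    refine mul_left_cancel₀ h0 ?_
    have h1 := EuclideanDomain.div_add_mod (p + q) (Polynomial.X ^ i)
    have h2 := EuclideanDomain.div_add_mod p (Polynomial.X ^ i)
    have h3 := EuclideanDomain.div_add_mod q (Polynomial.X ^ i)
    rw [Polynomial.add_mod] at h1
    linear_combination h1 - h2 - h3

theorem divXPow_apply (i : ℕ) (p : Polynomial Fq) : divXPow Fq i p = p / Polynomial.X ^ i := rfl

end Quotients

/-! ### The double cosets of the Siegel and Heisenberg families -/

section Siegel

variable {Fq : Type*} [Field Fq]

/-- The double coset of `(1 X; 0 1)` with `X` a symmetric matrix with entries `Tⁱ`, `b` and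
`⌊b² / Tⁱ⌋ + e`, where `T = π⁻¹`, so that `-det X` is `Tⁱ e` up to terms of degree less than `i`. -/
theorem kEquiv_siegel {i j : ℕ} (hj : j ≤ i) {b e : Polynomial Fq} (hb : b.degree < i)
    (he : e.degree = j) :
    KEquiv (siegel (polyEmb Fq (Polynomial.X ^ i)) (polyEmb Fq b)
      (polyEmb Fq (divXPow Fq i (b ^ 2) + e))) (cartan Fq i j) := by
  have hX0 : (Polynomial.X ^ i : Polynomial Fq) ≠ 0 := pow_ne_zero _ Polynomial.X_ne_zero
  have hX : Valued.v (polyEmb Fq (Polynomial.X ^ i)) = WithZero.exp (i : ℤ) :=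
    polyEmb_val_eq (Polynomial.degree_X_pow i)
  have hXne := ne_zero_of_val_eq_exp hX
  have h1 : (1 : WithZero (Multiplicative ℤ)) ≤ WithZero.exp (i : ℤ) := by
    rw [← WithZero.exp_zero, WithZero.exp_le_exp]
    positivity
  have h1j : (1 : WithZero (Multiplicative ℤ)) ≤ WithZero.exp (j : ℤ) := by
    rw [← WithZero.exp_zero, WithZero.exp_le_exp]
    positivity
  have hb' : Valued.v (polyEmb Fq b) ≤ WithZero.exp (i : ℤ) := (polyEmb_val_lt hb).le
  have hq : divXPow Fq i (b ^ 2) ∈ Polynomial.degreeLT Fq i := by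
    refine div_mem_degreeLT hX0 ?_
    rw [Polynomial.degree_X_pow, sq, Polynomial.degree_mul]
    rcases eq_or_ne b 0 with rfl | hb0
    · simp
    · rw [Polynomial.degree_eq_natDegree hb0] at hb ⊢
      norm_cast at hb ⊢
      omega
  have hd : Valued.v (polyEmb Fq (divXPow Fq i (b ^ 2) + e)) ≤ WithZero.exp (i : ℤ) := by
    rw [map_add]
    refine Valuation.map_add_le _ (polyEmb_val_lt (Polynomial.mem_degreeLT.mp hq)).le ?_
    rw [polyEmb_val_eq he, WithZero.exp_le_exp]
    exact_mod_cast hj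
  -- the entry of the Schur complement that determines `j`
  have hS : Valued.v (polyEmb Fq (divXPow Fq i (b ^ 2) + e) -
      polyEmb Fq b * polyEmb Fq b / polyEmb Fq (Polynomial.X ^ i)) = WithZero.exp (j : ℤ) := by
    have hdm := congrArg (polyEmb Fq) (EuclideanDomain.div_add_mod (b ^ 2) (Polynomial.X ^ i))
    rw [map_add, map_mul, map_pow _ b 2] at hdm
    have hmod : Valued.v (polyEmb Fq (b ^ 2 % Polynomial.X ^ i) /
        polyEmb Fq (Polynomial.X ^ i)) < 1 := by
      rw [map_div₀, hX]
      have hlt := polyEmb_val_lt (n := i) ((Polynomial.degree_mod_lt (b ^ 2) hX0).trans_eq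
        (Polynomial.degree_X_pow i))
      exact (div_lt_one₀ (zero_lt_one.trans_le h1)).mpr hlt
    have e1 : polyEmb Fq (divXPow Fq i (b ^ 2) + e) -
        polyEmb Fq b * polyEmb Fq b / polyEmb Fq (Polynomial.X ^ i) =
        polyEmb Fq e - polyEmb Fq (b ^ 2 % Polynomial.X ^ i) /
          polyEmb Fq (Polynomial.X ^ i) := by
      rw [map_add, divXPow_apply]
      field_simp
      linear_combination hdm
    rw [e1, Valuation.map_sub_eq_of_lt_left, polyEmb_val_eq he]
    rw [polyEmb_val_eq he]
    exact hmod.trans_le h1j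
  apply kEquiv_cartan_of_corner
  · simpa [siegel, Sp4.ofMatrix_val] using hX
  · intro k l
    fin_cases k <;> fin_cases l <;>
      simp [siegel, Sp4.ofMatrix_val, -map_add, -map_pow, h1, hb', hd, hX.le]
  · simpa [siegel, Sp4.ofMatrix_val] using h1j
  · simpa [siegel, Sp4.ofMatrix_val] using hS.le
  · simp [siegel, Sp4.ofMatrix_val]
  · simpa [siegel, Sp4.ofMatrix_val] using h1j
  · right
    simpa [siegel, Sp4.ofMatrix_val] using hS

end Siegel

section Heisenberg

variable {Fq : Type*} [Field Fq]

/-- The double cosets met by the Heisenberg family: `deg x = m`, `deg y < m`, `deg z = i`. The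
factor `blockDiag`, with an entry of degree `ε`, makes `i + j` odd for `ε = 1`; for `ε = 0` it lies
in `K`. -/
theorem kEquiv_heisenberg {i j m ε : ℕ} (hij : i + j = 2 * m + ε) (hεj : ε ≤ j) (hj : 1 ≤ j)
    (hm : m + ε ≤ i) {x y z : Polynomial Fq} (hx : x.degree = m) (hy : y.degree < m)
    (hz : z.degree = i) :
    KEquiv (blockDiag 1 1 1 (polyEmb Fq (Polynomial.X ^ ε)) 0 1 (by simp) (by simp) *
      heisenberg (polyEmb Fq x) (polyEmb Fq y) (polyEmb Fq z)) (cartan Fq i j) := by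
  have hw : Valued.v (polyEmb Fq (Polynomial.X ^ ε)) = WithZero.exp (ε : ℤ) :=
    polyEmb_val_eq (Polynomial.degree_X_pow ε)
  replace hx := polyEmb_val_eq hx
  replace hy := polyEmb_val_lt hy
  replace hz := polyEmb_val_eq hz
  set w := polyEmb Fq (Polynomial.X ^ ε)
  set x' := polyEmb Fq x
  set y' := polyEmb Fq y
  set z' := polyEmb Fq z
  have hwx : Valued.v (w * x') = WithZero.exp ((m + ε : ℕ) : ℤ) := by
    rw [map_mul, hw, hx, ← WithZero.exp_add]
    congr 1
    push_cast
    ring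
  have hr : Valued.v (y' - w * x') = WithZero.exp ((m + ε : ℕ) : ℤ) := by
    rw [Valuation.map_sub_eq_of_lt_right, hwx]
    rw [hwx]
    refine hy.trans_le ?_
    rw [WithZero.exp_le_exp]
    push_cast
    omega
  have hz0 := ne_zero_of_val_eq_exp hz
  have h1 : ∀ n : ℕ, (1 : WithZero (Multiplicative ℤ)) ≤ WithZero.exp (n : ℤ) := by
    intro n
    rw [← WithZero.exp_zero, WithZero.exp_le_exp]
    positivity
  have hprod : ∀ {p r : Fq⸨X⸩} {k l : ℕ}, Valued.v p ≤ WithZero.exp (k : ℤ) →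
      Valued.v r ≤ WithZero.exp (l : ℤ) → k + l ≤ i + j →
      Valued.v (p * r / z') ≤ WithZero.exp (j : ℤ) := by
    intro p r k l hp hr hkl
    rw [map_div₀, map_mul, hz]
    refine div_le_of_le_mul₀ zero_le zero_le ((mul_le_mul' hp hr).trans ?_)
    rw [← WithZero.exp_add, ← WithZero.exp_add, WithZero.exp_le_exp]
    omega
  have hS : Valued.v (1 - (y' - w * x') * x' / z') = WithZero.exp (j : ℤ) := by
    have hv : Valued.v ((y' - w * x') * x' / z') = WithZero.exp (j : ℤ) := by
      rw [map_div₀, map_mul, hr, hx, hz, ← WithZero.exp_add, ← WithZero.exp_sub]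
      congr 1
      push_cast
      omega
    rw [Valuation.map_sub_eq_of_lt_right, hv]
    rw [hv, map_one, ← WithZero.exp_zero, WithZero.exp_lt_exp]
    omega
  have hval : (blockDiag 1 1 1 w 0 1 (by simp) (by simp) * heisenberg x' y' z').1.val =
      !![1, x', y', z'; 0, 1, w, y' - w * x'; 0, 0, 1, -x'; 0, 0, 0, 1] := by
    rw [Sp4.mul_val]
    ext k l
    rw [Matrix.mul_apply, Fin.sum_univ_four]
    fin_cases k <;> fin_cases l <;>
      simp [blockDiag, heisenberg, Sp4.ofMatrix_val, sub_eq_add_neg]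
  have hle : ∀ {p : Fq⸨X⸩} {k : ℕ}, Valued.v p ≤ WithZero.exp (k : ℤ) → k ≤ i →
      Valued.v p ≤ WithZero.exp (i : ℤ) := by
    intro p k hp hk
    refine hp.trans ?_
    rw [WithZero.exp_le_exp]
    exact_mod_cast hk
  apply kEquiv_cartan_of_corner
  · rw [hval]
    simpa using hz
  · have e1 := hle hx.le (by omega)
    have e2 := hle hy.le (by omega)
    have e3 := hle hw.le (by omega)
    have e4 := hle hr.le (by omega)
    intro k l
    rw [hval]
    fin_cases k <;> fin_cases l <;> simp [h1, hz.le, e1, e2, e3, e4, Valuation.map_neg]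
  · rw [hval]
    simpa using hS.le
  · have : Valued.v (w - (y' - w * x') * y' / z') ≤ WithZero.exp (j : ℤ) := by
      refine Valuation.map_sub_le _ ?_ (hprod hr.le hy.le (by omega))
      rw [hw, WithZero.exp_le_exp]
      exact_mod_cast hεj
    rw [hval]
    simpa using this
  · have : Valued.v (0 - -x' * x' / z') ≤ WithZero.exp (j : ℤ) := by
      refine Valuation.map_sub_le _ (by simp) (hprod (k := m) ?_ hx.le (by omega))
      rw [Valuation.map_neg, hx]
    rw [hval]
    simpa using this
  · have : Valued.v (1 - -x' * y' / z') ≤ WithZero.exp (j : ℤ) := by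
      refine Valuation.map_sub_le _ (by simpa using h1 j) (hprod (k := m) ?_ hy.le (by omega))
      rw [Valuation.map_neg, hx]
    rw [hval]
    simpa using this
  · left
    rw [hval]
    simpa using hS

end Heisenberg

/-! ### Comparison of neighbouring double cosets -/

section Moves

variable {Fq : Type*} [Field Fq] {Λ : Subgroup (SpG Fq)}

/-- `siegel a b d` with polynomial entries, in a group that contains `H`. -/
def siegelIn (hΛ : SpH Fq ≤ Λ) (a b d : Polynomial Fq) : Λ :=
  ⟨siegel (polyEmb Fq a) (polyEmb Fq b) (polyEmb Fq d), hΛ (siegel_mem_SpH a b d)⟩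

theorem siegelIn_mul (hΛ : SpH Fq ≤ Λ) (a b d a' b' d' : Polynomial Fq) :
    siegelIn hΛ a b d * siegelIn hΛ a' b' d' = siegelIn hΛ (a + a') (b + b') (d + d') := by
  refine Subtype.ext ?_
  change siegel _ _ _ * siegel _ _ _ = siegel _ _ _
  rw [siegel_mul, map_add, map_add, map_add]

/-- `heisenberg x y z` with polynomial entries, in a group that contains `H`. -/
def heisenbergIn (hΛ : SpH Fq ≤ Λ) (x y z : Polynomial Fq) : Λ :=
  ⟨heisenberg (polyEmb Fq x) (polyEmb Fq y) (polyEmb Fq z), hΛ (heisenberg_mem_SpH x y z)⟩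

theorem heisenbergIn_mul (hΛ : SpH Fq ≤ Λ) (x y z x' y' z' : Polynomial Fq) :
    heisenbergIn hΛ x y z * heisenbergIn hΛ x' y' z' =
      heisenbergIn hΛ (x + x') (y + y') (z + z' + (x * y' - y * x')) := by
  refine Subtype.ext ?_
  change heisenberg _ _ _ * heisenberg _ _ _ = heisenberg _ _ _
  rw [heisenberg_mul]
  simp only [map_add, map_mul, map_sub]

theorem degree_mul_lt_of_lt {p q : Polynomial Fq} {m n : ℕ} (hp : p.degree < m)
    (hq : q.degree < n) : (p * q).degree < (m + n : ℕ) := by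
  rcases eq_or_ne p 0 with rfl | hp0
  · simp
  rcases eq_or_ne q 0 with rfl | hq0
  · simp
  rw [Polynomial.degree_mul, Polynomial.degree_eq_natDegree hp0,
    Polynomial.degree_eq_natDegree hq0] at *
  norm_cast at hp hq ⊢
  omega

theorem X_pow_mem_degreeLT {m n : ℕ} (h : m < n) :
    (Polynomial.X ^ m : Polynomial Fq) ∈ Polynomial.degreeLT Fq n := by
  rw [Polynomial.mem_degreeLT, Polynomial.degree_X_pow]
  exact_mod_cast h

/-- Comparison of `(i, j + 1)` and `(i, j)`. The differences `⌊(b + t)² / Xⁱ⌋ - ⌊b² / Xⁱ⌋` contain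
the term `⌊2 b t / Xⁱ⌋`, linear in `b`; when `deg t > j + 1` it takes the value
`X ^ (j + 1) - X ^ j`. -/
theorem norm_cartan_sub_le_of_siegel [Finite Fq] (hq : ringChar Fq ≠ 2) (hΛ : SpH Fq ≤ Λ)
    {c : SpG Fq → ℂ} (hc : ∀ g g', KEquiv g g' → c g = c g') {B : Set (SpG Fq)} {D : ℝ}
    (hD : 0 ≤ D) (hS : schurNorm Λ c B ≤ ENNReal.ofReal D) {i j : ℕ} (hij : j + 1 ≤ i)
    (hB : ∀ g, ∀ l ≤ i, KEquiv g (cartan Fq i l) → g ∈ B) {κ : ℝ} (hκ : 0 < κ)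
    (hκ' : (Nat.card Fq : ℝ) ^ (j + 2) ≤ κ ^ 2 * (Nat.card Fq : ℝ) ^ i) :
    ‖c (cartan Fq i (j + 1)) - c (cartan Fq i j)‖ ≤ 2 * κ * D := by
  classical
  let V := Polynomial.degreeLT Fq i
  let _ : Fintype V := Fintype.ofFinite V
  have hcardV : Fintype.card V = Nat.card Fq ^ i := by
    rw [← Nat.card_eq_fintype_card, card_degreeLT]
  let Z : Multiplicative (Polynomial Fq) →* Λ :=
    MonoidHom.mk' (fun e => siegelIn hΛ 0 0 e.toAdd) fun e e' => by
      rw [siegelIn_mul, toAdd_mul, add_zero]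
  have hZ : ∀ e, Z (.ofAdd e) = siegelIn hΛ 0 0 e := fun e => rfl
  let h : V → Λ := fun b =>
    siegelIn hΛ (Polynomial.X ^ i) b (divXPow Fq i ((b : Polynomial Fq) ^ 2))
  let L : V → V →+ Polynomial Fq := fun t =>
    ((divXPow Fq i).comp (AddMonoidHom.mulLeft (2 * (t : Polynomial Fq)))).comp
      V.subtype.toAddMonoidHom
  have hL : ∀ t b : V, L t b = divXPow Fq i (2 * (t : Polynomial Fq) * b) := fun t b => rfl
  have hhZ : ∀ b e, h b * Z (.ofAdd e) = siegelIn hΛ (Polynomial.X ^ i) b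
      (divXPow Fq i ((b : Polynomial Fq) ^ 2) + e) := by
    intro b e
    rw [hZ, siegelIn_mul, add_zero, add_zero]
  have hk : ∀ b t, (h b)⁻¹ * h (b + t) =
      siegelIn hΛ 0 t (divXPow Fq i ((t : Polynomial Fq) ^ 2)) * Z (.ofAdd (L t b)) := by
    intro b t
    rw [inv_mul_eq_iff_eq_mul, hZ, siegelIn_mul, siegelIn_mul, hL, ← map_add, ← map_add]
    change siegelIn hΛ _ _ _ = _
    congr 1
    · ring
    · rw [Submodule.coe_add]
      ring
    · rw [Submodule.coe_add]
      congr 1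
      ring
  have h2 : (2 : Polynomial Fq) ≠ 0 := by
    have : (2 : Fq) ≠ 0 := Ring.two_ne_zero hq
    rw [← Polynomial.C_ofNat]
    exact Polynomial.C_ne_zero.mpr this
  have hX0 : (Polynomial.X ^ i : Polynomial Fq) ≠ 0 := pow_ne_zero _ Polynomial.X_ne_zero
  let bad : Finset V := Finset.univ.filter
    fun t => (t : Polynomial Fq) ∈ Polynomial.degreeLT Fq (j + 2)
  have hcard : (bad.card : ℝ) ≤ κ ^ 2 * Fintype.card V := by
    have h1 : bad.card ≤ Nat.card Fq ^ (j + 2) := by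
      rw [← Fintype.card_subtype, ← Nat.card_eq_fintype_card, ← card_degreeLT]
      refine Nat.card_le_card_of_injective (fun t => ⟨(t.1 : Polynomial Fq), t.2⟩) ?_
      intro t t' htt
      have htt' := congrArg Subtype.val htt
      exact Subtype.ext (Subtype.ext htt')
    rw [hcardV]
    push_cast
    exact le_trans (by exact_mod_cast h1) hκ'
  have hbad : ∀ t ∉ bad, ∃ b, ∃ w ∈ (⊥ : AddSubgroup (Polynomial Fq)),
      Polynomial.X ^ (j + 1) - Polynomial.X ^ j = L t b + w := by
    intro t ht
    have htdeg : ((j + 2 : ℕ) : WithBot ℕ) ≤ (t : Polynomial Fq).degree := by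
      rw [← not_lt, ← Polynomial.mem_degreeLT]
      exact fun hmem => ht (Finset.mem_filter.mpr ⟨Finset.mem_univ _, hmem⟩)
    have ht0 : (t : Polynomial Fq) ≠ 0 := by
      intro h0
      rw [h0, Polynomial.degree_zero] at htdeg
      exact absurd htdeg (by simp)
    have h2t : 2 * (t : Polynomial Fq) ≠ 0 := mul_ne_zero h2 ht0
    have h2tdeg : (2 * (t : Polynomial Fq)).degree = (t : Polynomial Fq).degree := by
      rw [← Polynomial.C_ofNat, Polynomial.degree_C_mul (Ring.two_ne_zero hq)]
    set p : Polynomial Fq := Polynomial.X ^ (j + 1) - Polynomial.X ^ j with hp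
    have hpdeg : p.degree < ((j + 2 : ℕ) : WithBot ℕ) := Polynomial.mem_degreeLT.mp
      (sub_mem (X_pow_mem_degreeLT (by omega)) (X_pow_mem_degreeLT (by omega)))
    have hb : (Polynomial.X ^ i * p) / (2 * (t : Polynomial Fq)) ∈ V := by
      refine div_mem_degreeLT h2t ?_
      rw [Polynomial.degree_mul, Polynomial.degree_X_pow, h2tdeg]
      exact WithBot.add_lt_add_left (by simp) (hpdeg.trans_le htdeg)
    refine ⟨⟨_, hb⟩, 0, zero_mem _, ?_⟩
    rw [hL, add_zero, divXPow_apply]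
    -- the remainder of the division by `2 t` has degree less than `i`
    have hr : (Polynomial.X ^ i * p % (2 * (t : Polynomial Fq))).degree <
        (Polynomial.X ^ i : Polynomial Fq).degree := by
      refine (Polynomial.degree_mod_lt _ h2t).trans ?_
      rw [h2tdeg, Polynomial.degree_X_pow]
      exact Polynomial.mem_degreeLT.mp t.2
    have hdm := EuclideanDomain.div_add_mod (Polynomial.X ^ i * p) (2 * (t : Polynomial Fq))
    have h5 := map_add (divXPow Fq i)
      (2 * (t : Polynomial Fq) * (Polynomial.X ^ i * p / (2 * (t : Polynomial Fq))))
      (Polynomial.X ^ i * p % (2 * (t : Polynomial Fq)))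
    rw [hdm, divXPow_apply, divXPow_apply, divXPow_apply, (Polynomial.div_eq_zero_iff hX0).mpr hr,
      add_zero, mul_div_cancel_left₀ _ hX0] at h5
    exact h5
  let U := Polynomial.degreeLT Fq (2 * i + 2)
  let e : U × U × U → Λ := fun p => siegelIn hΛ p.1 p.2.1 p.2.2
  have hF : ∀ l, l ≤ i → ∀ b : V, ∀ w ∈ (⊥ : AddSubgroup (Polynomial Fq)),
      ∀ x ∈ (Set.finite_range e).toFinset, h b * Z (.ofAdd (w + Polynomial.X ^ l)) * x ∈
        (Set.finite_range e).toFinset := by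
    intro l hl b w hw x hx
    rw [AddSubgroup.mem_bot] at hw
    rw [Set.Finite.mem_toFinset] at hx ⊢
    obtain ⟨p, rfl⟩ := hx
    have hbU : (b : Polynomial Fq) ∈ U := Polynomial.degreeLT_mono (by omega) b.2
    have hdU : divXPow Fq i ((b : Polynomial Fq) ^ 2) ∈ U := by
      refine div_mem_degreeLT hX0 ?_
      have hb2 := degree_mul_lt_of_lt (Polynomial.mem_degreeLT.mp b.2)
        (Polynomial.mem_degreeLT.mp b.2)
      rw [sq, Polynomial.degree_X_pow]
      refine hb2.trans_le ?_
      norm_cast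
      omega
    refine ⟨⟨⟨Polynomial.X ^ i, X_pow_mem_degreeLT (by omega)⟩ + p.1, ⟨b, hbU⟩ + p.2.1,
      ⟨_, hdU⟩ + ⟨Polynomial.X ^ l, X_pow_mem_degreeLT (by omega)⟩ + p.2.2⟩, ?_⟩
    rw [hhZ, hw, zero_add]
    change siegelIn hΛ _ _ _ = _ * siegelIn hΛ _ _ _
    rw [siegelIn_mul]
    rfl
  have hval : ∀ l, l ≤ i → ∀ b : V, ∀ w ∈ (⊥ : AddSubgroup (Polynomial Fq)),
      ((1 * h b * Z (.ofAdd (w + Polynomial.X ^ l)) : Λ) : SpG Fq) ∈ B ∧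
      c ((1 * h b * Z (.ofAdd (w + Polynomial.X ^ l)) : Λ) : SpG Fq) = c (cartan Fq i l) := by
    intro l hl b w hw
    rw [AddSubgroup.mem_bot] at hw
    rw [hw, zero_add, one_mul, hhZ]
    have hKE := kEquiv_siegel (j := l) hl (Polynomial.mem_degreeLT.mp b.2)
      (Polynomial.degree_X_pow (R := Fq) l)
    exact ⟨hB _ l hl hKE, hc _ _ hKE⟩
  exact norm_sub_le_of_schurNorm_le hD hS (⊥ : AddSubgroup (Polynomial Fq)) 1 h _ Z L hk _ _ bad
    hbad hκ hcard (Set.finite_range e).toFinset ⟨e 0, by simp⟩ (hF (j + 1) hij)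
    (hF j (by omega)) (hval (j + 1) hij) (hval j (by omega))

/-- Comparison of `(i + 1, j)` and `(i, j + 1)`. The commutators of the Heisenberg group produce
`y * t`, linear in `y`; when `deg t` is large, these products and the polynomials of
degree less than `i` together span a space containing `X ^ (i + 1) - X ^ i`. -/
theorem norm_cartan_sub_le_of_heisenberg [Finite Fq] (hΛ : SpH Fq ≤ Λ)
    {c : SpG Fq → ℂ} (hc : ∀ g g', KEquiv g g' → c g = c g') {B : Set (SpG Fq)} {D : ℝ}
    (hD : 0 ≤ D) (hS : schurNorm Λ c B ≤ ENNReal.ofReal D) {i j : ℕ} (hj : 1 ≤ j) (hij : j < i)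
    (hB : ∀ g, ∀ k ≤ i + 1, ∀ l ≤ k, KEquiv g (cartan Fq k l) → g ∈ B) {κ : ℝ} (hκ : 0 < κ)
    (hκ' : (Nat.card Fq : ℝ) ^ 2 ≤ κ ^ 2 * (Nat.card Fq : ℝ) ^ j) :
    ‖c (cartan Fq (i + 1) j) - c (cartan Fq i (j + 1))‖ ≤ 2 * κ * D := by
  classical
  obtain ⟨m, ε, hm, hε⟩ : ∃ m ε : ℕ, i + 1 + j = 2 * m + ε ∧ ε ≤ 1 :=
    ⟨(i + 1 + j) / 2, (i + 1 + j) % 2, by omega, by omega⟩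
  let V := Polynomial.degreeLT Fq m
  let _ : Fintype V := Fintype.ofFinite V
  let W := (Polynomial.degreeLT Fq i).toAddSubgroup
  have : Finite W := degreeLT_finite i
  let _ : Fintype W := Fintype.ofFinite W
  have hcardV : Fintype.card V = Nat.card Fq ^ m := by
    rw [← Nat.card_eq_fintype_card, card_degreeLT]
  let Z : Multiplicative (Polynomial Fq) →* Λ :=
    MonoidHom.mk' (fun e => heisenbergIn hΛ 0 0 e.toAdd) fun e e' => by
      rw [heisenbergIn_mul, toAdd_mul]
      simp
  have hZ : ∀ e, Z (.ofAdd e) = heisenbergIn hΛ 0 0 e := fun e => rfl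
  let u : Λ := ⟨blockDiag 1 1 1 (polyEmb Fq (Polynomial.X ^ ε)) 0 1 (by simp) (by simp),
    hΛ (blockDiag_mem_SpH _)⟩
  let h : V × V → Λ := fun b => heisenbergIn hΛ (Polynomial.X ^ m + (b.1 : Polynomial Fq)) b.2 0
  let L : V × V → V × V →+ Polynomial Fq := fun t =>
    ((AddMonoidHom.mulRight (t.1 : Polynomial Fq)).comp V.subtype.toAddMonoidHom).comp
      (AddMonoidHom.snd V V) -
    ((AddMonoidHom.mulRight (t.2 : Polynomial Fq)).comp V.subtype.toAddMonoidHom).comp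
      (AddMonoidHom.fst V V)
  have hL : ∀ t b : V × V, L t b = (b.2 : Polynomial Fq) * t.1 - (b.1 : Polynomial Fq) * t.2 :=
    fun t b => rfl
  have hhZ : ∀ b e, h b * Z (.ofAdd e) = heisenbergIn hΛ
      (Polynomial.X ^ m + (b.1 : Polynomial Fq)) b.2 e := by
    intro b e
    rw [hZ, heisenbergIn_mul]
    simp
  have hk : ∀ b t, (h b)⁻¹ * h (b + t) =
      heisenbergIn hΛ t.1 t.2 (-(Polynomial.X ^ m * (t.2 : Polynomial Fq))) *
        Z (.ofAdd (L t b)) := by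
    intro b t
    rw [inv_mul_eq_iff_eq_mul, hZ, heisenbergIn_mul, heisenbergIn_mul, hL]
    change heisenbergIn hΛ _ _ _ = _
    congr 1
    · rw [Prod.fst_add, Submodule.coe_add]
      ring
    · rw [Prod.snd_add, Submodule.coe_add]
      ring
    · ring
  let bad : Finset (V × V) := Finset.univ.filter
    fun t => (t.1 : Polynomial Fq) ∈ Polynomial.degreeLT Fq (i + 2 - m)
  have hcard : (bad.card : ℝ) ≤ κ ^ 2 * Fintype.card (V × V) := by
    have h1 : bad.card ≤ Nat.card Fq ^ (i + 2 - m) * Nat.card Fq ^ m := by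
      rw [← Fintype.card_subtype, ← Nat.card_eq_fintype_card, ← card_degreeLT, ← card_degreeLT,
        ← Nat.card_prod]
      refine Nat.card_le_card_of_injective (fun t => (⟨(t.1.1 : Polynomial Fq), t.2⟩, t.1.2)) ?_
      intro t t' htt
      rw [Prod.mk.injEq] at htt
      have htt' := congrArg Subtype.val htt.1
      exact Subtype.ext (Prod.ext (Subtype.ext htt') htt.2)
    rw [Fintype.card_prod, hcardV]
    have h2 : (Nat.card Fq : ℝ) ^ (i + 2 - m) * (Nat.card Fq : ℝ) ^ m =
        (Nat.card Fq : ℝ) ^ (i + 2) := by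
      rw [← pow_add]
      congr 1
      omega
    have h3 : (Nat.card Fq : ℝ) ^ (i + 2) ≤ κ ^ 2 * (Nat.card Fq : ℝ) ^ (m + m) := by
      calc (Nat.card Fq : ℝ) ^ (i + 2) = Nat.card Fq ^ 2 * Nat.card Fq ^ i := by ring
        _ ≤ κ ^ 2 * Nat.card Fq ^ j * Nat.card Fq ^ i :=
          mul_le_mul_of_nonneg_right hκ' (by positivity)
        _ = κ ^ 2 * Nat.card Fq ^ (i + j) := by ring
        _ ≤ κ ^ 2 * Nat.card Fq ^ (m + m) := by
          refine mul_le_mul_of_nonneg_left ?_ (by positivity)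
          refine pow_le_pow_right₀ ?_ (by omega)
          exact_mod_cast Nat.card_pos (α := Fq)
    push_cast
    rw [← pow_add, ← h2] at *
    exact le_trans (by exact_mod_cast h1) h3
  have hbad : ∀ t ∉ bad, ∃ b, ∃ w ∈ W,
      Polynomial.X ^ (i + 1) - Polynomial.X ^ i = L t b + w := by
    intro t ht
    have htdeg : ((i + 2 - m : ℕ) : WithBot ℕ) ≤ (t.1 : Polynomial Fq).degree := by
      rw [← not_lt, ← Polynomial.mem_degreeLT]
      exact fun hmem => ht (Finset.mem_filter.mpr ⟨Finset.mem_univ _, hmem⟩)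
    have ht0 : (t.1 : Polynomial Fq) ≠ 0 := by
      intro h0
      rw [h0, Polynomial.degree_zero] at htdeg
      exact absurd htdeg (by simp)
    set p : Polynomial Fq := Polynomial.X ^ (i + 1) - Polynomial.X ^ i with hp
    have hpdeg : p.degree < ((i + 2 : ℕ) : WithBot ℕ) := Polynomial.mem_degreeLT.mp
      (sub_mem (X_pow_mem_degreeLT (by omega)) (X_pow_mem_degreeLT (by omega)))
    have hb : p / (t.1 : Polynomial Fq) ∈ V := by
      refine div_mem_degreeLT ht0 (hpdeg.trans_le ?_)
      rw [Polynomial.degree_eq_natDegree ht0] at htdeg ⊢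
      norm_cast at htdeg ⊢
      omega
    refine ⟨(0, ⟨_, hb⟩), p % (t.1 : Polynomial Fq), ?_, ?_⟩
    · refine Polynomial.mem_degreeLT.mpr ((Polynomial.degree_mod_lt _ ht0).trans_le ?_)
      refine (Polynomial.mem_degreeLT.mp t.1.2).le.trans ?_
      exact_mod_cast (by omega : m ≤ i)
    · rw [hL]
      have hdm := EuclideanDomain.div_add_mod p (t.1 : Polynomial Fq)
      simp only [ZeroMemClass.coe_zero, zero_mul, sub_zero]
      linear_combination -hdm
  let U := Polynomial.degreeLT Fq (m + 1)
  let U' := Polynomial.degreeLT Fq (i + 2 + 2 * m + 2)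
  let e : U × U × U' → Λ := fun p => heisenbergIn hΛ p.1 p.2.1 p.2.2
  have hF : ∀ l, l ≤ i + 1 → ∀ b : V × V, ∀ w ∈ W,
      ∀ x ∈ (Set.finite_range e).toFinset, h b * Z (.ofAdd (w + Polynomial.X ^ l)) * x ∈
        (Set.finite_range e).toFinset := by
    intro l hl b w hw x hx
    rw [Set.Finite.mem_toFinset] at hx ⊢
    obtain ⟨p, rfl⟩ := hx
    have hb₁ : Polynomial.X ^ m + (b.1 : Polynomial Fq) ∈ U :=
      add_mem (X_pow_mem_degreeLT (by omega)) (Polynomial.degreeLT_mono (by omega) b.1.2)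
    have hb₂ : (b.2 : Polynomial Fq) ∈ U := Polynomial.degreeLT_mono (by omega) b.2.2
    have hprod : ∀ {p r : Polynomial Fq}, p ∈ U → r ∈ U → p * r ∈ U' := by
      intro p r hp hr
      refine Polynomial.mem_degreeLT.mpr ((degree_mul_lt_of_lt (Polynomial.mem_degreeLT.mp hp)
        (Polynomial.mem_degreeLT.mp hr)).trans_le ?_)
      exact_mod_cast (by omega)
    have hz : w + Polynomial.X ^ l + (p.2.2 : Polynomial Fq) +
        ((Polynomial.X ^ m + (b.1 : Polynomial Fq)) * (p.2.1 : Polynomial Fq) -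
        (b.2 : Polynomial Fq) * (p.1 : Polynomial Fq)) ∈ U' :=
      add_mem (add_mem (add_mem (Polynomial.degreeLT_mono (by omega) hw)
        (X_pow_mem_degreeLT (by omega))) p.2.2.2)
        (sub_mem (hprod hb₁ p.2.1.2) (hprod hb₂ p.1.2))
    refine ⟨⟨⟨_, hb₁⟩ + p.1, ⟨_, hb₂⟩ + p.2.1, ⟨_, hz⟩⟩, ?_⟩
    rw [hhZ]
    change heisenbergIn hΛ _ _ _ = _ * heisenbergIn hΛ _ _ _
    rw [heisenbergIn_mul]
    rfl
  have hval : ∀ k l, i ≤ k → k ≤ i + 1 → k + l = i + 1 + j → 1 ≤ l → l ≤ k → ∀ b : V × V, ∀ w ∈ W,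
      ((u * h b * Z (.ofAdd (w + Polynomial.X ^ k)) : Λ) : SpG Fq) ∈ B ∧
      c ((u * h b * Z (.ofAdd (w + Polynomial.X ^ k)) : Λ) : SpG Fq) = c (cartan Fq k l) := by
    intro k l hik hki hkl hl hlk b w hw
    rw [mul_assoc, hhZ]
    have hwk : w.degree < (Polynomial.X ^ k : Polynomial Fq).degree := by
      rw [Polynomial.degree_X_pow]
      refine (Polynomial.mem_degreeLT.mp hw).trans_le ?_
      exact_mod_cast hik
    have hKE := kEquiv_heisenberg (Fq := Fq) (i := k) (j := l) (m := m) (ε := ε) (by omega)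
      (by omega) hl (by omega) (x := Polynomial.X ^ m + (b.1 : Polynomial Fq))
      (y := (b.2 : Polynomial Fq))
      (z := w + Polynomial.X ^ k)
      (by
        rw [Polynomial.degree_add_eq_left_of_degree_lt, Polynomial.degree_X_pow]
        rw [Polynomial.degree_X_pow]
        exact Polynomial.mem_degreeLT.mp b.1.2)
      (Polynomial.mem_degreeLT.mp b.2.2)
      (by rw [Polynomial.degree_add_eq_right_of_degree_lt hwk, Polynomial.degree_X_pow])
    exact ⟨hB _ k hki l hlk hKE, hc _ _ hKE⟩
  exact norm_sub_le_of_schurNorm_le hD hS W u h _ Z L hk _ _ bad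
    hbad hκ hcard (Set.finite_range e).toFinset ⟨e 0, by simp⟩ (hF (i + 1) le_rfl)
    (hF i (by omega)) (hval (i + 1) j (by omega) le_rfl (by omega) hj (by omega))
    (hval i (j + 1) le_rfl (by omega) (by omega) (by omega) (by omega))

end Moves

/-! ### Topology of the group and length functions -/

section Compact

variable {Fq : Type*} [Field Fq]

open Topology MonoidWithZeroHom.ValueGroup₀ in
theorem exists_ball_subset {x : Fq⸨X⸩} {s : Set Fq⸨X⸩} (hs : s ∈ 𝓝 x) :
    ∃ D : ℤ, ∀ y, Valued.v (y - x) ≤ WithZero.exp (-D) → y ∈ s := by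
  obtain ⟨γ, hγ⟩ := Valued.mem_nhds.mp hs
  refine ⟨-(WithZero.log (embedding γ.1) - 1), fun y hy => hγ ?_⟩
  change Valued.v.restrict (y - x) < γ.1
  rw [Valued.v.restrict_lt_iff_lt_embedding]
  refine hy.trans_lt ?_
  rw [← WithZero.lt_log_iff_exp_lt (by simp)]
  simp

theorem exists_single_mul_ofPowerSeries {n : ℕ} {x : Fq⸨X⸩}
    (hx : Valued.v x ≤ WithZero.exp (n : ℤ)) : ∃ a : ℕ → Fq,
      HahnSeries.single (-(n : ℤ)) 1 * HahnSeries.ofPowerSeries ℤ Fq (PowerSeries.mk a) = x := by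
  have h1 : Valued.v (HahnSeries.single (n : ℤ) 1 * x) ≤ 1 := by
    rw [map_mul, LaurentSeries.valuation_single_zpow]
    refine (mul_le_mul' le_rfl hx).trans ?_
    rw [← WithZero.exp_add, ← WithZero.exp_zero, WithZero.exp_le_exp]
    omega
  obtain ⟨p, hp⟩ := (LaurentSeries.val_le_one_iff_eq_coe Fq _).mp h1
  refine ⟨fun k => PowerSeries.coeff k p, ?_⟩
  have hp' : PowerSeries.mk (fun k => PowerSeries.coeff k p) = p := by
    ext k
    rw [PowerSeries.coeff_mk]
  rw [hp', hp, ← mul_assoc, single_mul_single_neg, one_mul]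

theorem isCompact_val_le [Finite Fq] (n : ℕ) :
    IsCompact {x : Fq⸨X⸩ | Valued.v x ≤ WithZero.exp (n : ℤ)} := by
  let _ : TopologicalSpace Fq := ⊥
  have : DiscreteTopology Fq := ⟨rfl⟩
  -- the ball is a continuous image of the compact space of coefficient sequences
  let Φ : (ℕ → Fq) → Fq⸨X⸩ := fun a =>
    HahnSeries.single (-(n : ℤ)) 1 * HahnSeries.ofPowerSeries ℤ Fq (PowerSeries.mk a)
  have hv : Valued.v (HahnSeries.single (-(n : ℤ)) 1 : Fq⸨X⸩) = WithZero.exp (n : ℤ) := by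
    rw [LaurentSeries.valuation_single_zpow, neg_neg]
  have hΦ : Continuous Φ := by
    rw [continuous_iff_continuousAt]
    intro a s hs
    obtain ⟨D, hD⟩ := exists_ball_subset hs
    have hopen : {b : ℕ → Fq | ∀ k ∈ Finset.range (D + n).toNat, b k = a k} ∈ nhds a := by
      have : {b : ℕ → Fq | ∀ k ∈ Finset.range (D + n).toNat, b k = a k} =
          ⋂ k ∈ Finset.range (D + n).toNat, (fun b : ℕ → Fq => b k) ⁻¹' {a k} := by
        ext b
        simp
      rw [this]
      refine (isOpen_biInter_finset fun k _ =>
        (isOpen_discrete _).preimage (continuous_apply k)).mem_nhds ?_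
      simp
    refine Filter.mem_map.mpr (Filter.mem_of_superset hopen fun b hb => hD _ ?_)
    change Valued.v (_ * _ - _ * _) ≤ _
    rw [← mul_sub, ← map_sub, map_mul, hv]
    have h1 : Valued.v (HahnSeries.ofPowerSeries ℤ Fq (PowerSeries.mk b - PowerSeries.mk a)) ≤
        WithZero.exp (-(D + n)) := by
      rw [LaurentSeries.valuation_le_iff_coeff_lt_eq_zero]
      intro m hm
      rcases lt_or_ge m 0 with hm0 | hm0
      · exact (PowerSeries.coeff_coe (PowerSeries.mk b - PowerSeries.mk a) m).trans (if_pos hm0)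
      · obtain ⟨k, rfl⟩ := Int.eq_ofNat_of_zero_le hm0
        rw [LaurentSeries.coeff_coe_powerSeries, map_sub, PowerSeries.coeff_mk,
          PowerSeries.coeff_mk, hb k (by rw [Finset.mem_range]; omega), sub_self]
    refine (mul_le_mul' le_rfl h1).trans ?_
    rw [← WithZero.exp_add, WithZero.exp_le_exp]
    omega
  have hrange : {x : Fq⸨X⸩ | Valued.v x ≤ WithZero.exp (n : ℤ)} = Set.range Φ := by
    refine Set.Subset.antisymm (fun x hx => ?_) ?_
    · exact exists_single_mul_ofPowerSeries hx
    · rintro _ ⟨a, rfl⟩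
      rw [Set.mem_ofPred_eq, map_mul, hv]
      exact (mul_le_mul' le_rfl ((LaurentSeries.val_le_one_iff_eq_coe Fq _).mpr ⟨_, rfl⟩)).trans
        (mul_one _).le
  rw [hrange]
  exact isCompact_range hΦ

theorem continuous_entry (k l : Fin 4) : Continuous fun g : SpG Fq => g.1.val k l :=
  (Units.continuous_val.comp continuous_subtype_val).matrix_elem k l

theorem isCompact_entries_le [Finite Fq] (n : ℕ) :
    IsCompact {g : SpG Fq | ∀ k l, Valued.v (g.1.val k l) ≤ WithZero.exp (n : ℤ)} := by
  let Y : Set (Matrix (Fin 4) (Fin 4) Fq⸨X⸩) :=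
    {A | A * sympJ Fq⸨X⸩ * A.transpose = sympJ Fq⸨X⸩}
  have hcont : Continuous fun A : Matrix (Fin 4) (Fin 4) Fq⸨X⸩ =>
      A * sympJ Fq⸨X⸩ * A.transpose :=
    (continuous_id.matrix_mul continuous_const).matrix_mul continuous_id.matrix_transpose
  have hcont' : Continuous fun A : Matrix (Fin 4) (Fin 4) Fq⸨X⸩ =>
      -(sympJ Fq⸨X⸩ * A.transpose * sympJ Fq⸨X⸩) :=
    ((continuous_const.matrix_mul continuous_id.matrix_transpose).matrix_mul
      continuous_const).neg
  have hY : IsClosed Y := by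
    have h := (isClosed_singleton (x := sympJ Fq⸨X⸩)).preimage hcont
    exact h
  have hc : IsCompact {A : Matrix (Fin 4) (Fin 4) Fq⸨X⸩ |
      ∀ k l, Valued.v (A k l) ≤ WithZero.exp (n : ℤ)} := by
    have h1 := isCompact_univ_pi fun _ : Fin 4 =>
      isCompact_univ_pi fun _ : Fin 4 => isCompact_val_le (Fq := Fq) n
    have h2 : {A : Matrix (Fin 4) (Fin 4) Fq⸨X⸩ |
        ∀ k l, Valued.v (A k l) ≤ WithZero.exp (n : ℤ)} = Set.pi Set.univ fun _ : Fin 4 =>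
        Set.pi Set.univ fun _ : Fin 4 => {x : Fq⸨X⸩ | Valued.v x ≤ WithZero.exp (n : ℤ)} := by
      refine Set.ext fun A => ⟨fun h k _ l _ => h k l, fun h k l => ?_⟩
      exact h k (Set.mem_univ k) l (Set.mem_univ l)
    rw [h2]
    exact h1
  have hc' := hY.isClosedEmbedding_subtypeVal.isCompact_preimage hc
  let f : Y → SpG Fq := fun A => Sp4.ofMatrix A.1 A.2
  have hf : Continuous f := by
    refine Continuous.subtype_mk (Units.continuous_iff.mpr ⟨continuous_subtype_val, ?_⟩) _
    exact hcont'.comp continuous_subtype_val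
  convert hc'.image hf using 1
  ext g
  constructor
  · intro hg
    exact ⟨⟨g.1.val, g.2⟩, hg, Sp4.ext rfl⟩
  · rintro ⟨A, hA, rfl⟩
    exact hA

theorem isOpen_SpK : IsOpen (SpK Fq : Set (SpG Fq)) := by
  have h : (SpK Fq : Set (SpG Fq)) = ⋂ k, ⋂ l, (fun g : SpG Fq => g.1.val k l) ⁻¹'
      ((Valued.v (R := Fq⸨X⸩)).integer : Set Fq⸨X⸩) := by
    ext g
    simp only [SetLike.mem_coe, mem_SpK_iff, Set.mem_iInter, Set.mem_preimage,
      Valuation.mem_integer_iff]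
  rw [h]
  exact isOpen_iInter_of_finite fun k => isOpen_iInter_of_finite fun l =>
    (Valued.isOpen_integer _).preimage (continuous_entry k l)

theorem isCompact_SpK [Finite Fq] : IsCompact (SpK Fq : Set (SpG Fq)) := by
  convert isCompact_entries_le (Fq := Fq) 0 using 1
  ext g
  simp [mem_SpK_iff]

/-- The exponent `i` of the double coset `K D(i, j) K` of `g`: the largest entry of `g` has norm
`qⁱ`. -/
def maxExponent (g : SpG Fq) : ℕ :=
  sInf {n : ℕ | ∀ k l, Valued.v (g.1.val k l) ≤ WithZero.exp (n : ℤ)}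

theorem maxExponent_spec (g : SpG Fq) :
    (∀ k l, Valued.v (g.1.val k l) ≤ WithZero.exp (maxExponent g : ℤ)) ∧
      ∃ k l, Valued.v (g.1.val k l) = WithZero.exp (maxExponent g : ℤ) := by
  obtain ⟨n, hn, k, l, hkl⟩ := exists_max_entry g
  have h : maxExponent g = n := by
    refine le_antisymm (Nat.sInf_le hn) (le_csInf ⟨n, hn⟩ fun m hm => ?_)
    have h1 := hm k l
    rw [hkl, WithZero.exp_le_exp] at h1
    exact_mod_cast h1
  rw [h]
  exact ⟨hn, k, l, hkl⟩

theorem maxExponent_mul_of_mem {g k : SpG Fq} (hk : k ∈ SpK Fq) :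
    maxExponent (g * k) = maxExponent g := by
  unfold maxExponent
  congr 1
  ext n
  constructor
  · intro h i j
    have h1 := val_mul_le_of_mem_right (inv_mem hk) h i j
    rwa [mul_inv_cancel_right] at h1
  · exact fun h => val_mul_le_of_mem_right hk h

theorem continuous_maxExponent : Continuous (maxExponent (Fq := Fq)) := by
  refine IsLocallyConstant.continuous ((IsLocallyConstant.iff_exists_open _).mpr fun g => ?_)
  refine ⟨(fun x => g⁻¹ * x) ⁻¹' (SpK Fq : Set (SpG Fq)),
    isOpen_SpK.preimage (continuous_const_mul g⁻¹), ?_, fun x hx => ?_⟩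
  · change g⁻¹ * g ∈ SpK Fq
    rw [inv_mul_cancel]
    exact one_mem _
  · rw [← maxExponent_mul_of_mem (g := g) hx, mul_inv_cancel_left]

theorem cartan_mul (i j i' j' : ℕ) :
    cartan Fq i j * cartan Fq i' j' = cartan Fq (i + i') (j + j') := by
  rw [cartan, cartan, cartan, blockDiag_mul]
  refine blockDiag_congr _ _ _ _ ?_ ?_ ?_ ?_ ?_ ?_ <;>
    simp [HahnSeries.single_mul_single] <;> ring_nf

theorem cartan_zero_zero : cartan Fq 0 0 = 1 := by
  refine Sp4.ext (Matrix.ext fun i j => ?_)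
  rw [Sp4.one_val]
  fin_cases i <;> fin_cases j <;> simp [cartan, blockDiag, Sp4.ofMatrix_val]

/-- A continuous length function grows at most linearly in the exponent `i` of the double
coset. -/
theorem exists_length_bound [Finite Fq] (ℓ : GroupSeminorm (SpG Fq)) (hℓ : Continuous ℓ) :
    ∃ κ : ℝ, 0 < κ ∧ ∀ g, ∀ i j, j ≤ i → KEquiv g (cartan Fq i j) → ℓ g ≤ κ * (i + 1) := by
  obtain ⟨M, hM⟩ := (isCompact_SpK (Fq := Fq)).bddAbove_image hℓ.continuousOn
  have hMK : ∀ k ∈ SpK Fq, ℓ k ≤ M := fun k hk => hM ⟨k, hk, rfl⟩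
  have hM0 : 0 ≤ M := by simpa using hMK 1 (one_mem _)
  set A := ℓ (cartan Fq 1 0) + ℓ (cartan Fq 1 1) with hA
  have hA1 : 0 ≤ ℓ (cartan Fq 1 0) := apply_nonneg ℓ _
  have hA2 : 0 ≤ ℓ (cartan Fq 1 1) := apply_nonneg ℓ _
  have hcartan : ∀ i j, j ≤ i → ℓ (cartan Fq i j) ≤ A * i := by
    intro i
    induction i with
    | zero =>
      intro j hj
      rw [Nat.le_zero.mp hj, cartan_zero_zero, map_one_eq_zero]
      simp
    | succ i ih =>
      intro j hj
      push_cast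
      rcases Nat.eq_zero_or_pos j with rfl | hj0
      · have h1 := map_mul_le_add ℓ (cartan Fq i 0) (cartan Fq 1 0)
        rw [cartan_mul] at h1
        have h2 := ih 0 (Nat.zero_le _)
        linarith
      · obtain ⟨j, rfl⟩ : ∃ l, j = l + 1 := ⟨j - 1, by omega⟩
        have h1 := map_mul_le_add ℓ (cartan Fq i j) (cartan Fq 1 1)
        rw [cartan_mul] at h1
        have h2 := ih j (by omega)
        linarith
  refine ⟨2 * M + A + 1, by positivity, ?_⟩
  rintro g i j hj ⟨k, hk, k', hk', hg⟩
  have hg' : g = k⁻¹ * cartan Fq i j * k'⁻¹ := by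
    rw [← hg]
    group
  have h1 := map_mul_le_add ℓ (k⁻¹ * cartan Fq i j) k'⁻¹
  have h2 := map_mul_le_add ℓ k⁻¹ (cartan Fq i j)
  have h3 := hMK _ (inv_mem hk)
  have h4 := hMK _ (inv_mem hk')
  have h5 := hcartan i j hj
  rw [← hg'] at h1
  have h6 : (0 : ℝ) ≤ i := Nat.cast_nonneg i
  nlinarith

end Compact

/-! ### The zigzag argument -/

/-- The constant in the exponential rate of convergence. -/
def zigzagConst (τ : ℝ) : ℝ :=
  (Real.exp τ + Real.exp (2 * τ) +
    (1 / τ + (1 + Real.exp (8 * τ) + 1 / τ) / (1 - Real.exp (-τ)))) * Real.exp τ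

/-- Suppose that `a i j`, for `j ≤ i`, varies little from `(i, j)` to `(i, j + 1)` as long as
`i - j` is large, and from `(i, j + 1)` to `(i + 1, j)` as long as `j` is large. Then `a i j`
converges exponentially fast in `i`, uniformly in `j`. -/
theorem exists_limit_of_zigzag {τ M : ℝ} (hτ : 0 < τ) (hM : 0 ≤ M) {a : ℕ → ℕ → ℂ}
    (h₀ : ∀ i j, j ≤ i → ‖a i j‖ ≤ M * Real.exp (τ * i))
    (h₁ : ∀ i j, j + 1 ≤ i →
      ‖a i (j + 1) - a i j‖ ≤ M * Real.exp (τ * (i + 16 * (j - i))))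
    (h₂ : ∀ i j, 1 ≤ j → j < i →
      ‖a (i + 1) j - a i (j + 1)‖ ≤ M * Real.exp (τ * (i - 16 * j))) :
    ∃ L : ℂ, ∀ i j, j ≤ i → ‖a i j - L‖ ≤ zigzagConst τ * M * Real.exp (-τ * i) := by
  have hexp : ∀ {x y : ℝ}, x ≤ y → M * Real.exp (τ * x) ≤ M * Real.exp (τ * y) := by
    intro x y hxy
    exact mul_le_mul_of_nonneg_left
      (Real.exp_le_exp.mpr (mul_le_mul_of_nonneg_left hxy hτ.le)) hM
  set ρ := Real.exp (-τ) with hρ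
  have hρ0 : 0 < ρ := Real.exp_pos _
  have hρ1 : ρ < 1 := Real.exp_lt_one_iff.mpr (by linarith)
  have hρpow : ∀ i : ℕ, Real.exp (τ * (-(i : ℝ))) = ρ ^ i := by
    intro i
    rw [hρ, ← Real.exp_nat_mul]
    congr 1
    ring
  have hρsucc : ∀ i : ℕ, ρ ^ (i + 1) ≤ ρ ^ i := fun i =>
    pow_le_pow_of_le_one hρ0.le hρ1.le (Nat.le_succ i)
  -- steps that change `j` below the line `2 j = i`
  have hlow' : ∀ i j k, 2 * (j + k) ≤ i + 1 → j + k ≤ i →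
      ‖a i (j + k) - a i j‖ ≤ k * (M * Real.exp (τ * (-7 * i))) := by
    intro i j k
    induction k with
    | zero => simp
    | succ k ih =>
      intro hk hki
      have h3 := h₁ i (j + k) (by omega)
      have h4 := ih (by omega) (by omega)
      have h5 : M * Real.exp (τ * ((i : ℝ) + 16 * (((j + k : ℕ) : ℝ) - i))) ≤
          M * Real.exp (τ * (-7 * i)) := by
        refine hexp ?_
        have : 2 * ((j : ℝ) + k) + 1 ≤ i := by exact_mod_cast (by omega : 2 * (j + k) + 1 ≤ i)
        push_cast
        linarith
      have h6 := norm_sub_le_norm_sub_add_norm_sub (a i (j + (k + 1))) (a i (j + k)) (a i j)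
      rw [← add_assoc] at h6 ⊢
      push_cast
      linarith
  have hlow : ∀ i j, 2 * j ≤ i → ‖a i j - a i (i / 2)‖ ≤ M * (1 / τ) * ρ ^ i := by
    intro i j hj
    have h3 := hlow' i j (i / 2 - j) (by omega) (by omega)
    rw [show j + (i / 2 - j) = i / 2 by omega, norm_sub_rev] at h3
    refine h3.trans ?_
    have h4 : ((i / 2 - j : ℕ) : ℝ) ≤ i := by exact_mod_cast (by omega : i / 2 - j ≤ i)
    have h5 : (i : ℝ) ≤ 1 / τ * Real.exp (τ * i) := by
      have := Real.add_one_le_exp (τ * i)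
      rw [one_div, inv_mul_eq_div, le_div_iff₀ hτ]
      linarith
    have h6 : M * Real.exp (τ * (-7 * i)) ≤ M * Real.exp (τ * (-2 * i)) :=
      hexp (by have : (0 : ℝ) ≤ i := Nat.cast_nonneg i
               linarith)
    calc ((i / 2 - j : ℕ) : ℝ) * (M * Real.exp (τ * (-7 * i)))
        ≤ (1 / τ * Real.exp (τ * i)) * (M * Real.exp (τ * (-2 * i))) :=
          mul_le_mul (h4.trans h5) h6 (by positivity) (by positivity)
      _ = M * (1 / τ) * (Real.exp (τ * i) * Real.exp (τ * (-2 * i))) := by ring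
      _ = M * (1 / τ) * ρ ^ i := by
          rw [← Real.exp_add, ← hρpow]
          congr 2
          ring
  -- steps that keep `i + j` constant above that line
  have hdiag : ∀ i j, 1 ≤ j → j < i → i ≤ 2 * j + 1 →
      ‖a (i + 1) j - a i (j + 1)‖ ≤ M * Real.exp (8 * τ) * ρ ^ i := by
    intro i j hj hji hij
    refine (h₂ i j hj hji).trans ?_
    have h3 : (i : ℝ) ≤ 2 * j + 1 := by exact_mod_cast hij
    have h4 : (0 : ℝ) ≤ i := Nat.cast_nonneg i
    have h5 : M * Real.exp (τ * ((i : ℝ) - 16 * j)) ≤ M * Real.exp (τ * (8 + -(i : ℝ))) :=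
      hexp (by linarith)
    rw [mul_add, Real.exp_add, hρpow, mul_comm τ 8, ← mul_assoc] at h5
    exact h5
  set K₁ := 1 + Real.exp (8 * τ) + 1 / τ with hK₁
  have hanchor : ∀ i, 2 ≤ i →
      ‖a i (i / 2) - a (i + 1) ((i + 1) / 2)‖ ≤ K₁ * M * ρ ^ i := by
    intro i hi
    have h3 : ‖a i (i / 2 + 1) - a i (i / 2)‖ ≤ M * ρ ^ i := by
      refine (h₁ i (i / 2) (by omega)).trans ?_
      rw [← hρpow]
      refine hexp ?_
      have : 2 * ((i / 2 : ℕ) : ℝ) ≤ i := by exact_mod_cast (by omega : 2 * (i / 2) ≤ i)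
      have h4 : (0 : ℝ) ≤ i := Nat.cast_nonneg i
      linarith
    have h4 := hdiag i (i / 2) (by omega) (by omega) (by omega)
    have h5 := hlow (i + 1) (i / 2) (by omega)
    have h6 : M * (1 / τ) * ρ ^ (i + 1) ≤ M * (1 / τ) * ρ ^ i :=
      mul_le_mul_of_nonneg_left (hρsucc i) (by positivity)
    have h7 := norm_sub_le_norm_sub_add_norm_sub (a i (i / 2)) (a i (i / 2 + 1))
      (a (i + 1) ((i + 1) / 2))
    have h8 := norm_sub_le_norm_sub_add_norm_sub (a i (i / 2 + 1)) (a (i + 1) (i / 2))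
      (a (i + 1) ((i + 1) / 2))
    rw [norm_sub_rev] at h3 h4
    have h9 : K₁ * M * ρ ^ i = M * ρ ^ i + M * Real.exp (8 * τ) * ρ ^ i +
        M * (1 / τ) * ρ ^ i := by
      rw [hK₁]
      ring
    linarith
  have hseq : ∀ n : ℕ, dist (a (n + 2) ((n + 2) / 2)) (a (n + 1 + 2) ((n + 1 + 2) / 2)) ≤
      K₁ * M * ρ ^ 2 * ρ ^ n := by
    intro n
    rw [dist_eq_norm]
    refine (hanchor (n + 2) (by omega)).trans (le_of_eq ?_)
    ring
  obtain ⟨L, hL⟩ := cauchySeq_tendsto_of_complete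
    (cauchySeq_of_le_geometric ρ (K₁ * M * ρ ^ 2) hρ1 hseq)
  have hlim : ∀ i, 2 ≤ i → ‖a i (i / 2) - L‖ ≤ K₁ / (1 - ρ) * M * ρ ^ i := by
    intro i hi
    obtain ⟨n, rfl⟩ : ∃ n, i = n + 2 := ⟨i - 2, by omega⟩
    have h3 := dist_le_of_le_geometric_of_tendsto ρ (K₁ * M * ρ ^ 2) hρ1 hseq hL n
    rw [dist_eq_norm] at h3
    refine h3.trans (le_of_eq ?_)
    ring
  set K₂ := 1 / τ + K₁ / (1 - ρ) with hK₂
  have h1ρ : 0 < 1 - ρ := by linarith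
  have hbase : ∀ i j, 2 ≤ i → 2 * j ≤ i → ‖a i j - L‖ ≤ K₂ * M * ρ ^ i := by
    intro i j hi hj
    have h3 := norm_sub_le_norm_sub_add_norm_sub (a i j) (a i (i / 2)) L
    have h4 := hlow i j hj
    have h5 := hlim i hi
    have h6 : K₂ * M * ρ ^ i = M * (1 / τ) * ρ ^ i + K₁ / (1 - ρ) * M * ρ ^ i := by
      rw [hK₂]
      ring
    linarith
  have hK₂' : Real.exp (8 * τ) ≤ K₂ * (1 - ρ) := by
    have h3 : K₂ * (1 - ρ) = 1 / τ * (1 - ρ) + K₁ := by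
      rw [hK₂]
      field_simp
    have h4 : 0 < 1 / τ * (1 - ρ) := by positivity
    have h5 : 0 < 1 / τ := by positivity
    linarith
  have hall : ∀ j i, 2 ≤ i → j ≤ i → ‖a i j - L‖ ≤ K₂ * M * ρ ^ i := by
    intro j
    induction j with
    | zero => exact fun i hi _ => hbase i 0 hi (by omega)
    | succ j ih =>
      intro i hi hji
      rcases le_or_gt (2 * (j + 1)) i with hle | hgt
      · exact hbase i (j + 1) hi hle
      · have h3 := hdiag i j (by omega) (by omega) (by omega)
        have h4 := ih (i + 1) (by omega) (by omega)
        have h5 := norm_sub_le_norm_sub_add_norm_sub (a i (j + 1)) (a (i + 1) j) L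
        rw [norm_sub_rev] at h3
        have h6 : M * ρ ^ i * Real.exp (8 * τ) ≤ M * ρ ^ i * (K₂ * (1 - ρ)) :=
          mul_le_mul_of_nonneg_left hK₂' (by positivity)
        rw [pow_succ] at h4
        linarith
  have hK₂0 : 0 < K₂ := by positivity
  have hconst : zigzagConst τ = (Real.exp τ + Real.exp (2 * τ) + K₂) * Real.exp τ := rfl
  refine ⟨L, fun i j hji => ?_⟩
  have hpow : Real.exp (-τ * i) = ρ ^ i := by
    rw [← hρpow]
    congr 1
    ring
  rw [hpow]
  have hτ1 : 1 ≤ Real.exp τ := Real.one_le_exp hτ.le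
  have hS : 0 < Real.exp τ + Real.exp (2 * τ) := by positivity
  rcases le_or_gt 2 i with hi | hi
  · refine (hall j i hi hji).trans ?_
    have h3 : K₂ ≤ zigzagConst τ := by
      rw [hconst]
      nlinarith
    exact mul_le_mul_of_nonneg_right (mul_le_mul_of_nonneg_right h3 hM) (by positivity)
  · -- the double cosets with `i ≤ 1` are isolated, and the trivial bound suffices
    have h3 : ‖a i j‖ ≤ M * Real.exp τ := by
      refine (h₀ i j hji).trans ?_
      have h4 := hexp (x := i) (y := 1) (by exact_mod_cast (by omega : i ≤ 1))
      rwa [mul_one] at h4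
    have h4 : ‖a 2 1‖ ≤ M * Real.exp (2 * τ) := by
      have := h₀ 2 1 (by omega)
      push_cast at this
      rwa [mul_comm τ 2] at this
    have h5 : ‖a 2 1 - L‖ ≤ K₂ * M := by
      refine (hall 1 2 le_rfl (by omega)).trans ?_
      exact mul_le_of_le_one_right (by positivity) (pow_le_one₀ hρ0.le hρ1.le)
    have h6 := norm_sub_le_norm_sub_add_norm_sub (a i j) (a 2 1) L
    have h7 := norm_sub_le (a i j) (a 2 1)
    have h8 : 1 ≤ Real.exp τ * ρ ^ i := by
      have h9 : Real.exp τ * ρ = 1 := by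
        rw [hρ, ← Real.exp_add, add_neg_cancel, Real.exp_zero]
      interval_cases i
      · simpa using hτ1
      · rw [pow_one, h9]
    have h9 : (Real.exp τ + Real.exp (2 * τ) + K₂) * M * 1 ≤
        (Real.exp τ + Real.exp (2 * τ) + K₂) * M * (Real.exp τ * ρ ^ i) :=
      mul_le_mul_of_nonneg_left h8 (by positivity)
    rw [hconst]
    linarith

/-! ### Property `(T_Schur, G, K)` -/

section Final

variable {Fq : Type*} [Field Fq]

/-- The trivial bound for a multiplier. -/
theorem norm_cartan_le {Λ : Subgroup (SpG Fq)} (hΛ : SpH Fq ≤ Λ)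
    {c : SpG Fq → ℂ} (hc : ∀ g g', KEquiv g g' → c g = c g') {B : Set (SpG Fq)} {D : ℝ}
    (hD : 0 ≤ D) (hS : schurNorm Λ c B ≤ ENNReal.ofReal D) {i j : ℕ} (hij : j ≤ i)
    (hB : ∀ g, KEquiv g (cartan Fq i j) → g ∈ B) :
    ‖c (cartan Fq i j)‖ ≤ D := by
  have hKE := kEquiv_siegel (Fq := Fq) (b := 0) hij (by simp) (Polynomial.degree_X_pow j)
  set h : Λ := siegelIn hΛ (Polynomial.X ^ i) 0 (divXPow Fq i (0 ^ 2) + Polynomial.X ^ j) with hh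
  have hn : ∀ z : ℂ, reducedNorm (Finsupp.single h z) = ‖z‖ := by
    intro z
    refine le_antisymm (ContinuousLinearMap.opNorm_le_bound _ (norm_nonneg _) fun ξ => ?_) ?_
    · rw [leftRegular_single, norm_smul, LinearIsometry.norm_map]
    · obtain ⟨ξ, hξ, -⟩ := exists_invariant_vector ({1} : Finset Λ) ⟨1, by simp⟩ ∅ (by simp)
      have h1 := (leftRegular (Finsupp.single h z)).le_opNorm ξ
      rw [leftRegular_single, norm_smul, LinearIsometry.norm_map] at h1
      exact le_of_mul_le_mul_right h1 (norm_pos_iff.mpr hξ)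
  have h2 := reducedNorm_schurProduct_le hD hS one_pos (Finsupp.single h (1 : ℂ))
    (fun x hx => by
      rw [Finset.mem_singleton.mp (Finsupp.support_single_subset hx)]
      exact hB _ hKE) (by rw [hn, norm_one])
  rw [schurProduct_single, Finsupp.smul_single, hn, smul_eq_mul, mul_one, one_mul] at h2
  rw [← hc _ _ hKE]
  exact h2

/-- The function `K₀ * exp (-τ i)` on the double coset of exponents `(i, j)`. -/
def decay [Finite Fq] (K₀ τ : ℝ) (hτ : 0 < τ) : C₀(SpG Fq, ℝ) where
  toFun g := K₀ * Real.exp (-τ * maxExponent g)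
  continuous_toFun := by
    have h : Continuous fun n : ℕ => K₀ * Real.exp (-τ * n) := continuous_of_discreteTopology
    exact h.comp continuous_maxExponent
  zero_at_infty' := by
    have h1 : Filter.Tendsto (fun n : ℕ => K₀ * Real.exp (-τ * n)) Filter.atTop (nhds 0) := by
      rw [← mul_zero K₀]
      refine Filter.Tendsto.const_mul K₀ (Real.tendsto_exp_atBot.comp ?_)
      exact tendsto_natCast_atTop_atTop.const_mul_atTop_of_neg (by linarith)
    refine h1.comp ?_
    rw [Filter.tendsto_atTop]
    intro n
    -- the elements of bounded exponent form a compact set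
    refine Filter.mem_of_superset (isCompact_entries_le (Fq := Fq) n).compl_mem_cocompact ?_
    intro g hg
    by_contra hlt
    refine hg fun k l => ((maxExponent_spec g).1 k l).trans ?_
    rw [WithZero.exp_le_exp]
    have : ¬ n ≤ maxExponent g := hlt
    omega

theorem decay_apply [Finite Fq] (K₀ τ : ℝ) (hτ : 0 < τ) (g : SpG Fq) :
    decay K₀ τ hτ g = K₀ * Real.exp (-τ * maxExponent g) := rfl

/-- Every discrete subgroup that contains `H` has property `(T_Schur, G, K)`. -/
theorem hasTSchur_of_le [Finite Fq] (hq : ringChar Fq ≠ 2) (Λ : Subgroup (SpG Fq))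
    [DiscreteTopology Λ] (hΛ : SpH Fq ≤ Λ) : HasTSchur (SpK Fq) Λ := by
  intro ℓ hℓ
  obtain ⟨κ, hκ, hlen⟩ := exists_length_bound ℓ hℓ
  set q : ℝ := ((Nat.card Fq : ℕ) : ℝ) with hqdef
  have hq1 : 1 < q := by
    rw [hqdef]
    exact_mod_cast Finite.one_lt_card (α := Fq)
  -- the loss `exp (s n)` is at most `exp (τ i)`, while the moves gain powers of `q = exp (32 τ)`
  set τ := Real.log q / 32 with hτdef
  have hτ : 0 < τ := div_pos (Real.log_pos hq1) (by norm_num)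
  have hqpow : ∀ n : ℕ, q ^ n = Real.exp (32 * τ * n) := by
    intro n
    rw [hτdef, mul_div_cancel₀ _ (by norm_num), mul_comm, Real.exp_nat_mul,
      Real.exp_log (by linarith)]
  refine ⟨τ / κ, by positivity, fun s hs0 hs => ?_⟩
  have hsκ : s * κ ≤ τ := ((lt_div_iff₀ hκ).mp hs).le
  set E := 2 * Real.exp (34 * τ + s) with hE
  refine ⟨decay (zigzagConst τ * E) τ hτ, fun C hC c hcK hS => ?_⟩
  have hc : ∀ g g', KEquiv g g' → c g = c g' := by
    rintro g _ ⟨k, hk, k', hk', rfl⟩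
    exact (hcK k hk k' hk' g).symm
  set D : ℕ → ℝ := fun i => C * Real.exp (s * ⌈κ * (i + 1)⌉₊) with hDdef
  have hD0 : ∀ i, 0 ≤ D i := fun i => by positivity
  have hDle : ∀ i : ℕ, D i ≤ C * Real.exp (τ * (i + 1) + s) := by
    intro i
    refine mul_le_mul_of_nonneg_left (Real.exp_le_exp.mpr ?_) hC.le
    have h1 : (⌈κ * ((i : ℝ) + 1)⌉₊ : ℝ) ≤ κ * (i + 1) + 1 :=
      (Nat.ceil_lt_add_one (by positivity)).le
    have h2 : s * κ * ((i : ℝ) + 1) ≤ τ * (i + 1) :=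
      mul_le_mul_of_nonneg_right hsκ (by positivity)
    nlinarith
  have hB : ∀ i : ℕ, ∀ g, ∀ k ≤ i, ∀ l ≤ k, KEquiv g (cartan Fq k l) →
      g ∈ {g : SpG Fq | ℓ g ≤ (⌈κ * ((i : ℝ) + 1)⌉₊ : ℕ)} := by
    intro i g k hki l hlk hg
    refine (hlen g k l hlk hg).trans (le_trans ?_ (Nat.le_ceil _))
    have : (k : ℝ) ≤ i := by exact_mod_cast hki
    exact mul_le_mul_of_nonneg_left (by linarith) hκ.le
  have hzig := exists_limit_of_zigzag hτ (M := C * E) (by positivity)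
    (a := fun i j => c (cartan Fq i j)) ?_ ?_ ?_
  · obtain ⟨L, hL⟩ := hzig
    refine ⟨L, fun g => ?_⟩
    obtain ⟨j, hj, hg⟩ := exists_kEquiv_cartan g (maxExponent_spec g).1 (maxExponent_spec g).2
    rw [hc _ _ hg, decay_apply]
    exact (hL _ j hj).trans (le_of_eq (by ring))
  · intro i j hji
    refine (norm_cartan_le hΛ hc (hD0 i) (hS _) hji fun g hg => hB i g i le_rfl j hji hg).trans ?_
    refine (hDle i).trans ?_
    rw [hE, mul_assoc C, mul_assoc 2, ← Real.exp_add]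
    refine mul_le_mul_of_nonneg_left ?_ hC.le
    have h1 : Real.exp (τ * (i + 1) + s) ≤ Real.exp (34 * τ + s + τ * i) :=
      Real.exp_le_exp.mpr (by linarith)
    linarith [Real.exp_pos (τ * (i + 1) + s)]
  · intro i j hij
    refine (norm_cartan_sub_le_of_siegel hq hΛ hc (hD0 i) (hS _) hij
      (fun g l hl hg => hB i g i le_rfl l hl hg) (κ := Real.exp (16 * τ * (j + 2 - i)))
      (Real.exp_pos _) (le_of_eq ?_)).trans ?_
    · change q ^ (j + 2) = _ * q ^ i
      rw [hqpow, hqpow, ← Real.exp_nat_mul, ← Real.exp_add]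
      congr 1
      push_cast
      ring
    · calc 2 * Real.exp (16 * τ * (j + 2 - i)) * D i
          ≤ 2 * Real.exp (16 * τ * (j + 2 - i)) * (C * Real.exp (τ * (i + 1) + s)) :=
            mul_le_mul_of_nonneg_left (hDle i) (by positivity)
        _ = 2 * C * (Real.exp (16 * τ * (j + 2 - i)) * Real.exp (τ * (i + 1) + s)) := by ring
        _ ≤ 2 * C * (Real.exp (34 * τ + s) * Real.exp (τ * (i + 16 * (j - i)))) := by
            rw [← Real.exp_add, ← Real.exp_add]
            refine mul_le_mul_of_nonneg_left (Real.exp_le_exp.mpr ?_) (by positivity)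
            linarith
        _ = C * E * Real.exp (τ * (i + 16 * (j - i))) := by
            rw [hE]
            ring
  · intro i j hj hji
    refine (norm_cartan_sub_le_of_heisenberg hΛ hc (hD0 (i + 1)) (hS _) hj hji
      (hB (i + 1)) (κ := Real.exp (16 * τ * (2 - j)))
      (Real.exp_pos _) (le_of_eq ?_)).trans ?_
    · change q ^ 2 = _ * q ^ j
      rw [hqpow, hqpow, ← Real.exp_nat_mul, ← Real.exp_add]
      congr 1
      push_cast
      ring
    · have hD1 := hDle (i + 1)
      push_cast at hD1
      calc 2 * Real.exp (16 * τ * (2 - j)) * D (i + 1)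
          ≤ 2 * Real.exp (16 * τ * (2 - j)) * (C * Real.exp (τ * (i + 1 + 1) + s)) :=
            mul_le_mul_of_nonneg_left hD1 (by positivity)
        _ = 2 * C * (Real.exp (16 * τ * (2 - j)) * Real.exp (τ * (i + 1 + 1) + s)) := by ring
        _ = 2 * C * (Real.exp (34 * τ + s) * Real.exp (τ * (i - 16 * j))) := by
            rw [← Real.exp_add, ← Real.exp_add]
            congr 2
            ring
        _ = C * E * Real.exp (τ * (i - 16 * j)) := by
            rw [hE]
            ring

end Final

end

theorem theorem1p1 (Fq : Type*) [Field Fq] [Finite Fq] (hq : ringChar Fq ≠ 2) :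
    HasTSchur (SpK Fq) (SpH Fq) ∧ HasTSchur (SpK Fq) (SpΓ Fq) :=
  ⟨hasTSchur_of_le hq _ le_rfl, hasTSchur_of_le hq _ inf_le_left⟩
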